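/- Let $k$ be any field. An endomorphism $f=(f_1,\dots,f_n)$ of $\mathbb{A}^n=\mathbb{A}^n_k$ is an $n$-tuple of polynomials in $k[x_1,\dots,x_n]$; it is an automorphism if it is invertible for composition, and $\deg f=\max_i\deg f_i$. The dynamical degree of $f$ is $\lim_{r\to\infty}\deg(f^r)^{1/r}$. An endomorphism $\tau$ is triangular if $\tau_i\in k[x_1,\dots,x_i]$ for all $i$; $f$ is affine-triangular (respectively permutation-triangular) if $f=\alpha\circ\tau$ with $\tau$ triangular and $\alpha$ an automorphism of degree $1$ (respectively a permutation of the coordinates). An endomorphism of $\mathbb{A}^{n+1}$ is shift-like if it has the form $(x_{n+1}+p(x_1,\dots,x_n),x_1,\dots,x_n)$ with $p\in k[x_1,\dots,x_n]$. A weak Perron number is a real algebraic integer $\lambda\ge 1$ all of whose Galois conjugates $\mu\in\mathbb{C}$ satisfy $|\mu|\le\lambda$. **Proposition.** Let $\lambda\in\mathbb{R}$ be a weak Perron number that is a quadratic integer, with minimal polynomial $x^2-ax-b$, where $a,b\in\mathbb{Z}$. Then $a\ge 0$, and the following hold. 1. If $b\ge 0$, then $\lambda$ is the dynamical degree of the shift-like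 automorphism $(x_3+x_1^a x_2^b,\,x_1,\,x_2)$ of $\mathbb{A}^3$. 2. If $b<0$, then $\lambda$ is not the dynamical degree of any affine-triangular automorphism of $\mathbb{A}^3$. However, put $\alpha=\lfloor a/2\rfloor$ and $$A=(a_{i,j})=\begin{pmatrix}\alpha & 1\\ \alpha(a-\alpha)+b & a-\alpha\end{pmatrix}.$$ Then $A$ has non-negative integer entries, is irreducible, has spectral radius greater than $1$, and $\lambda$ is the dynamical degree of $$\left(x_3+x_1^{a_{1,1}}x_2^{a_{1,2}},\;x_4+x_1^{a_{2,1}}x_2^{a_{2,2}},\;x_1,\;x_2\right)=\left(x_3+x_1^{\alpha}x_2,\;x_4+x_1^{\alpha(a-\alpha)+b}x_2^{a-\alpha},\;x_1,\;x_2\right),$$ which is a permutation-triangular automorphism of $\mathbb{A}^4$. -/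

import Mathlib

open MvPolynomial Filter Topology

/-- Endomorphisms `f = (f_1, …, f_n)` of the affine space of dimension `n` over `k`,
identified with `n`-tuples of polynomials in `n` variables. The variable written `x_i` on paper
is `X (i - 1)`, since `Fin n` starts at `0`. -/
abbrev AffEnd (k : Type*) [Field k] (n : ℕ) : Type _ := Fin n → MvPolynomial (Fin n) k

namespace AffEnd

noncomputable section

/-- The identity `(x_1, …, x_n)`. -/
def one (k : Type*) [Field k] (n : ℕ) : AffEnd k n := fun i => X i

/-- The composition `f ∘ g = (f_1(g_1, …, g_n), …, f_n(g_1, …, g_n))`. -/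
def comp {k : Type*} [Field k] {n : ℕ} (f g : AffEnd k n) : AffEnd k n :=
  fun i => aeval g (f i)

/-- The iterate `f^r = f ∘ ⋯ ∘ f`. -/
def iter {k : Type*} [Field k] {n : ℕ} (f : AffEnd k n) : ℕ → AffEnd k n
  | 0 => one k n
  | r + 1 => comp f (iter f r)

/-- `deg f = max (deg f_1, …, deg f_n)`. -/
def deg {k : Type*} [Field k] {n : ℕ} (f : AffEnd k n) : ℕ :=
  Finset.univ.sup fun i => (f i).totalDegree

/-- `f` is invertible in the monoid of endomorphisms. -/
def IsAutomorphism {k : Type*} [Field k] {n : ℕ} (f : AffEnd k n) : Prop :=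
  ∃ g : AffEnd k n, comp f g = one k n ∧ comp g f = one k n

/-- `l` is the dynamical degree of `f`, that is, the limit of `deg (f^r)^(1/r)`. -/
def IsDynamicalDegree {k : Type*} [Field k] {n : ℕ} (f : AffEnd k n) (l : ℝ) : Prop :=
  Tendsto (fun r : ℕ => ((deg (iter f r) : ℕ) : ℝ) ^ (1 / (r : ℝ))) atTop (𝓝 l)

/-- `f_i` only involves the variables `x_1, …, x_i`. -/
def IsTriangular {k : Type*} [Field k] {n : ℕ} (f : AffEnd k n) : Prop :=
  ∀ i, f i ∈ supported k {j : Fin n | j ≤ i}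

def IsAffineAutomorphism {k : Type*} [Field k] {n : ℕ} (f : AffEnd k n) : Prop :=
  IsAutomorphism f ∧ deg f = 1

/-- `{f_1, …, f_n} = {x_1, …, x_n}`. -/
def IsCoordinatePermutation {k : Type*} [Field k] {n : ℕ} (f : AffEnd k n) : Prop :=
  Set.range f = Set.range (X : Fin n → MvPolynomial (Fin n) k)

def IsAffineTriangular {k : Type*} [Field k] {n : ℕ} (f : AffEnd k n) : Prop :=
  ∃ α τ : AffEnd k n, IsAffineAutomorphism α ∧ IsTriangular τ ∧ f = comp α τ

def IsPermutationTriangular {k : Type*} [Field k] {n : ℕ} (f : AffEnd k n) : Prop :=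
  ∃ α τ : AffEnd k n, IsCoordinatePermutation α ∧ IsTriangular τ ∧ f = comp α τ

/-- `f = (x_{n+1} + p(x_1, …, x_n), x_1, …, x_n)` for some polynomial `p`. -/
def IsShiftLike {k : Type*} [Field k] {n : ℕ} (f : AffEnd k (n + 1)) : Prop :=
  ∃ p : MvPolynomial (Fin n) k,
    f = Fin.cons (X (Fin.last n) + rename Fin.castSucc p) (fun i : Fin n => X i.castSucc)

/-- The endomorphism of the affine space of dimension `2n` whose `j`-th component is
`x_{n+j} + ∏ i, x_i ^ (A j i)` and whose `(n+j)`-th component is `x_j`, for `1 ≤ j ≤ n`. -/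
def ofMatrix (k : Type*) [Field k] {n : ℕ} (A : Matrix (Fin n) (Fin n) ℕ) : AffEnd k (n + n) :=
  Fin.append (fun j => X (Fin.natAdd n j) + ∏ i, X (Fin.castAdd n i) ^ A j i)
    (fun j => X (Fin.castAdd n j))

end

end AffEnd

/-- A weak Perron number: a real algebraic integer `l ≥ 1` all of whose Galois conjugates in `ℂ`
have absolute value at most `l`. -/
def IsWeakPerron (l : ℝ) : Prop :=
  1 ≤ l ∧ IsIntegral ℤ l ∧ ∀ μ : ℂ, Polynomial.aeval μ (minpoly ℚ l) = 0 → ‖μ‖ ≤ l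

/-! The method is to give the variables real weights `μ i`. If every component `f i` has weight at
most `θ * μ i` with all `μ i > 0`, then the components of `f^r` have weight at most `θ ^ r * μ i`,
so the degrees of the iterates are `O(θ ^ r)`. Conversely, let `g i` be the part of `f i` of weight
exactly `θ * μ i`. Then `g^r` is the top part of `f^r`; if one of its coordinates of positive weight
never vanishes, the degrees are bounded below by a positive multiple of `θ ^ r`. Together these
bounds give `isDynamicalDegree_of_weight`. For the explicit maps in dimensions 3 and 4 the top parts
are monomials, so nothing vanishes, and the weights come from an eigenvector of the matrix of
exponents.

For the negative statement, Gaussian elimination conjugates an affine-triangular automorphism of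
affine 3-space into a form where the component `f i` is a non-zero multiple of the variable `π i`
plus a polynomial in the previous variables, for a permutation `π` (`exists_conj_hasLevel`). For
each of the six permutations a suitable weight, sometimes after one more conjugation, shows that the
dynamical degree is at most 1 or satisfies `l ^ 2 = a * l + b` with natural numbers `a`, `b`
(`IsDynamicalDegree.leOneOrQuadratic_of_hasLevel`). There the top part is no longer a monomial, and
its iterates are non-zero because its relevant components are algebraically independent
(`eq_zero_of_mem_supported_insert`). Since an irrational `l` satisfies only one such equation
(`eq_of_sq_eq`), a negative `b` is excluded. -/

/-! ### Weighted degrees and top parts of polynomials. -/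

section Weights

variable {k : Type*} [Field k] {n : ℕ} {μ : Fin n → ℝ}

/-- Polynomials all of whose monomials have weight at most `s`. -/
noncomputable def weightLE (k : Type*) [Field k] {n : ℕ} (μ : Fin n → ℝ) (s : ℝ) :
    Submodule k (MvPolynomial (Fin n) k) :=
  restrictSupport k {m | Finsupp.weight μ m ≤ s}

/-- Polynomials all of whose monomials have weight less than `s`. -/
noncomputable def weightLT (k : Type*) [Field k] {n : ℕ} (μ : Fin n → ℝ) (s : ℝ) :
    Submodule k (MvPolynomial (Fin n) k) :=
  restrictSupport k {m | Finsupp.weight μ m < s}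

theorem mem_weightLE {s : ℝ} {p : MvPolynomial (Fin n) k} :
    p ∈ weightLE k μ s ↔ ∀ m, coeff m p ≠ 0 → Finsupp.weight μ m ≤ s := by
  simp [weightLE, mem_restrictSupport_iff, Set.subset_def]

theorem mem_weightLT {s : ℝ} {p : MvPolynomial (Fin n) k} :
    p ∈ weightLT k μ s ↔ ∀ m, coeff m p ≠ 0 → Finsupp.weight μ m < s := by
  simp [weightLT, mem_restrictSupport_iff, Set.subset_def]

theorem weightLT_le_weightLE (s : ℝ) : weightLT k μ s ≤ weightLE k μ s :=
  restrictSupport_mono _ fun _ h => le_of_lt (Set.mem_ofPred.1 h)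

theorem weightLE_mono {s t : ℝ} (h : s ≤ t) : weightLE k μ s ≤ weightLE k μ t :=
  restrictSupport_mono _ fun _ hm => le_trans hm h

theorem weightLE_le_weightLT {s t : ℝ} (h : s < t) : weightLE k μ s ≤ weightLT k μ t :=
  restrictSupport_mono _ fun _ hm => lt_of_le_of_lt hm h

theorem mul_mem_weightLT {s t : ℝ} {p q : MvPolynomial (Fin n) k} (hp : p ∈ weightLE k μ s)
    (hq : q ∈ weightLT k μ t) : p * q ∈ weightLT k μ (s + t) := by
  classical
  rw [mem_weightLE] at hp
  rw [mem_weightLT] at *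
  intro m hm
  rw [coeff_mul] at hm
  obtain ⟨x, hx, hne⟩ := Finset.exists_ne_zero_of_sum_ne_zero hm
  rw [Finset.HasAntidiagonal.mem_antidiagonal] at hx
  rw [← hx, map_add]
  exact add_lt_add_of_le_of_lt (hp _ (left_ne_zero_of_mul hne)) (hq _ (right_ne_zero_of_mul hne))

theorem monomial_mem_weightLE {s : ℝ} {m : Fin n →₀ ℕ} (c : k) (h : Finsupp.weight μ m ≤ s) :
    monomial m c ∈ weightLE k μ s := by
  classical
  rw [mem_weightLE]
  intro m' hm'
  rw [coeff_monomial] at hm'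
  obtain rfl : m = m' := by_contra fun hne => hm' (if_neg hne)
  exact h

theorem C_mem_weightLE {s : ℝ} (c : k) (h : 0 ≤ s) :
    (C c : MvPolynomial (Fin n) k) ∈ weightLE k μ s :=
  monomial_mem_weightLE c (by simpa using h)

theorem C_mem_weightLT {s : ℝ} (c : k) (h : 0 < s) :
    (C c : MvPolynomial (Fin n) k) ∈ weightLT k μ s :=
  weightLE_le_weightLT h (C_mem_weightLE c le_rfl)

theorem X_mem_weightLE {s : ℝ} (i : Fin n) (h : μ i ≤ s) :
    (X i : MvPolynomial (Fin n) k) ∈ weightLE k μ s :=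
  monomial_mem_weightLE 1 (by simpa [Finsupp.weight_single] using h)

theorem C_mul_mem_weightLE {s : ℝ} (c : k) {p : MvPolynomial (Fin n) k}
    (h : p ∈ weightLE k μ s) : C c * p ∈ weightLE k μ s := by
  rw [← smul_eq_C_mul]; exact Submodule.smul_mem _ _ h

theorem C_mul_mem_weightLT {s : ℝ} (c : k) {p : MvPolynomial (Fin n) k}
    (h : p ∈ weightLT k μ s) : C c * p ∈ weightLT k μ s := by
  rw [← smul_eq_C_mul]; exact Submodule.smul_mem _ _ h

/-- `g` is the part of weight `s` of `p`, and `p` has no monomial of larger weight. -/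
def HasTop (μ : Fin n → ℝ) (s : ℝ) (p g : MvPolynomial (Fin n) k) : Prop :=
  IsWeightedHomogeneous μ g s ∧ p - g ∈ weightLT k μ s

namespace HasTop

variable {s t : ℝ} {p q g h : MvPolynomial (Fin n) k}

theorem homogeneous_mem (hg : IsWeightedHomogeneous μ g s) : g ∈ weightLE k μ s :=
  mem_weightLE.2 fun _ hm => (hg hm).le

theorem mem (hp : HasTop μ s p g) : p ∈ weightLE k μ s := by
  have := add_mem (weightLT_le_weightLE s hp.2) (homogeneous_mem hp.1)
  simpa using this

theorem of_homogeneous (hg : IsWeightedHomogeneous μ g s) : HasTop μ s g g :=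
  ⟨hg, by simp⟩

theorem of_lt (hp : p ∈ weightLT k μ s) : HasTop μ s p 0 :=
  ⟨isWeightedHomogeneous_zero _ _ _, by simpa using hp⟩

theorem add (hp : HasTop μ s p g) (hq : HasTop μ s q h) : HasTop μ s (p + q) (g + h) :=
  ⟨hp.1.add hq.1, by
    have := add_mem hp.2 hq.2
    rwa [add_sub_add_comm]⟩

theorem mul (hp : HasTop μ s p g) (hq : HasTop μ t q h) : HasTop μ (s + t) (p * q) (g * h) := by
  refine ⟨hp.1.mul hq.1, ?_⟩
  have h1 := mul_mem_weightLT hp.mem hq.2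
  have h2 := mul_mem_weightLT (homogeneous_mem hq.1) hp.2
  rw [add_comm t s] at h2
  have := add_mem h1 h2
  convert this using 1
  ring

theorem C_mul (c : k) (hp : HasTop μ s p g) : HasTop μ s (C c * p) (C c * g) :=
  ⟨hp.1.C_mul c, by rw [← mul_sub]; exact C_mul_mem_weightLT c hp.2⟩

theorem one : HasTop μ 0 (1 : MvPolynomial (Fin n) k) 1 :=
  of_homogeneous (isWeightedHomogeneous_one _ _)

theorem X (i : Fin n) : HasTop μ (μ i) (X i : MvPolynomial (Fin n) k) (MvPolynomial.X i) :=
  of_homogeneous (isWeightedHomogeneous_X _ _ _)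

theorem pow (hp : HasTop μ s p g) (a : ℕ) : HasTop μ (a * s) (p ^ a) (g ^ a) := by
  induction a with
  | zero => simpa using one
  | succ a ih => simpa [pow_succ, add_mul] using ih.mul hp

theorem prod {ι : Type*} (S : Finset ι) (u v : ι → MvPolynomial (Fin n) k) (w : ι → ℝ)
    (huv : ∀ i ∈ S, HasTop μ (w i) (u i) (v i)) :
    HasTop μ (∑ i ∈ S, w i) (∏ i ∈ S, u i) (∏ i ∈ S, v i) := by
  classical
  induction S using Finset.induction_on with
  | empty => simpa using one
  | insert a S ha ih =>
    rw [Finset.sum_insert ha, Finset.prod_insert ha, Finset.prod_insert ha]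
    exact (huv a (by simp)).mul (ih fun i hi => huv i (by simp [hi]))

theorem sum {ι : Type*} (S : Finset ι) (u v : ι → MvPolynomial (Fin n) k)
    (huv : ∀ i ∈ S, HasTop μ s (u i) (v i)) :
    HasTop μ s (∑ i ∈ S, u i) (∑ i ∈ S, v i) := by
  classical
  induction S using Finset.induction_on with
  | empty => simpa using of_lt (zero_mem _)
  | insert a S ha ih =>
    rw [Finset.sum_insert ha, Finset.sum_insert ha]
    exact (huv a (by simp)).add (ih fun i hi => huv i (by simp [hi]))

/-- The top part of a polynomial is its component of weight `s`. -/
theorem of_mem (hp : p ∈ weightLE k μ s) : HasTop μ s p (weightedHomogeneousComponent μ s p) := by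
  classical
  refine ⟨weightedHomogeneousComponent_isWeightedHomogeneous _ _, mem_weightLT.2 fun m hm => ?_⟩
  rw [coeff_sub, coeff_weightedHomogeneousComponent] at hm
  split_ifs at hm with hms
  · simp at hm
  · exact lt_of_le_of_ne (mem_weightLE.1 hp m (by simpa using hm)) hms

theorem coeff_eq (hp : HasTop μ s p g) {m : Fin n →₀ ℕ} (hm : Finsupp.weight μ m = s) :
    coeff m p = coeff m g := by
  by_contra hne
  have := mem_weightLT.1 hp.2 m (by rw [coeff_sub]; exact sub_ne_zero.2 hne)
  linarith

theorem prod_pow {ρ : ℝ} {u v : Fin n → MvPolynomial (Fin n) k}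
    (huv : ∀ i, HasTop μ (ρ * μ i) (u i) (v i)) (m : Fin n →₀ ℕ) :
    HasTop μ (ρ * Finsupp.weight μ m) (∏ i, u i ^ m i) (∏ i, v i ^ m i) := by
  have := prod Finset.univ _ _ _ fun i _ => (huv i).pow (m i)
  convert this using 1
  rw [Finsupp.weight_eq_sum, Finset.mul_sum]
  refine Finset.sum_congr rfl fun i _ => ?_
  rw [nsmul_eq_mul]; ring

end HasTop

theorem aeval_eq_sum_univ (u : Fin n → MvPolynomial (Fin n) k) (p : MvPolynomial (Fin n) k) :
    aeval u p = ∑ m ∈ p.support, C (coeff m p) * ∏ i, u i ^ m i := by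
  rw [aeval_def, eval₂_eq']; rfl

theorem prod_pow_mem_weightLE {ρ : ℝ} {u : Fin n → MvPolynomial (Fin n) k}
    (hu : ∀ i, u i ∈ weightLE k μ (ρ * μ i)) (m : Fin n →₀ ℕ) :
    ∏ i, u i ^ m i ∈ weightLE k μ (ρ * Finsupp.weight μ m) :=
  (HasTop.prod_pow (fun i => HasTop.of_mem (hu i)) m).mem

theorem aeval_mem_weightLE {s ρ : ℝ} (hρ : 0 ≤ ρ) {p : MvPolynomial (Fin n) k}
    (hp : p ∈ weightLE k μ s) {u : Fin n → MvPolynomial (Fin n) k}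
    (hu : ∀ i, u i ∈ weightLE k μ (ρ * μ i)) : aeval u p ∈ weightLE k μ (ρ * s) := by
  rw [aeval_eq_sum_univ]
  refine sum_mem fun m hm => C_mul_mem_weightLE _ ?_
  exact weightLE_mono (mul_le_mul_of_nonneg_left (mem_weightLE.1 hp m (mem_support_iff.1 hm)) hρ)
    (prod_pow_mem_weightLE hu m)

theorem aeval_mem_weightLT {s ρ : ℝ} (hρ : 0 < ρ) {p : MvPolynomial (Fin n) k}
    (hp : p ∈ weightLT k μ s) {u : Fin n → MvPolynomial (Fin n) k}
    (hu : ∀ i, u i ∈ weightLE k μ (ρ * μ i)) : aeval u p ∈ weightLT k μ (ρ * s) := by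
  rw [aeval_eq_sum_univ]
  refine sum_mem fun m hm => C_mul_mem_weightLT _ ?_
  exact weightLE_le_weightLT
    (mul_lt_mul_of_pos_left (mem_weightLT.1 hp m (mem_support_iff.1 hm)) hρ)
    (prod_pow_mem_weightLE hu m)

/-- The substitution multiplies weights by `ρ`; as `ρ > 0`, what lies strictly below the top part
stays strictly below it. The polynomial `aeval v g` may vanish, so non-vanishing is always a
separate matter. -/
theorem HasTop.aeval {s ρ : ℝ} (hρ : 0 < ρ) {p g : MvPolynomial (Fin n) k} (hp : HasTop μ s p g)
    {u v : Fin n → MvPolynomial (Fin n) k} (huv : ∀ i, HasTop μ (ρ * μ i) (u i) (v i)) :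
    HasTop μ (ρ * s) (aeval u p) (aeval v g) := by
  have h1 : HasTop μ (ρ * s) (MvPolynomial.aeval u g) (MvPolynomial.aeval v g) := by
    rw [aeval_eq_sum_univ, aeval_eq_sum_univ]
    refine HasTop.sum _ _ _ fun m hm => HasTop.C_mul _ ?_
    have := HasTop.prod_pow huv m
    rwa [hp.1 (mem_support_iff.1 hm)] at this
  have h2 := HasTop.of_lt (aeval_mem_weightLT hρ hp.2 fun i => (huv i).mem)
  have := h1.add h2
  rwa [add_zero, ← map_add, add_sub_cancel] at this

end Weights

/-! ### Degree growth of iterates and its control by weights. -/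

namespace AffEnd

variable {k : Type*} [Field k] {n : ℕ}

theorem aeval_aeval (g h : AffEnd k n) (p : MvPolynomial (Fin n) k) :
    aeval h (aeval g p) = aeval (comp g h) p := by
  have : ((aeval h).comp (aeval g) : MvPolynomial (Fin n) k →ₐ[k] _) = aeval (comp g h) := by
    ext i; simp [comp]
  exact DFunLike.congr_fun this p

theorem comp_assoc (f g h : AffEnd k n) : comp (comp f g) h = comp f (comp g h) := by
  funext i
  rw [comp, comp, comp, aeval_aeval]

theorem comp_one (f : AffEnd k n) : comp f (one k n) = f :=
  funext fun i => by
    have : (aeval (one k n) : MvPolynomial (Fin n) k →ₐ[k] _) = AlgHom.id k _ := aeval_X_left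
    rw [comp, this, AlgHom.id_apply]

theorem one_comp (f : AffEnd k n) : comp (one k n) f = f :=
  funext fun i => by simp [comp, one]

theorem iter_conj {β β' : AffEnd k n} (h1 : comp β β' = one k n) (h2 : comp β' β = one k n)
    (f : AffEnd k n) (r : ℕ) :
    iter (comp (comp β f) β') r = comp (comp β (iter f r)) β' := by
  induction r with
  | zero => simp [iter, comp_one, h1]
  | succ r ih =>
    rw [iter, ih, iter, comp_assoc, comp_assoc β (iter f r), ← comp_assoc β' β, h2, one_comp,
      comp_assoc, comp_assoc, comp_assoc]

theorem totalDegree_le_deg (f : AffEnd k n) (i : Fin n) : (f i).totalDegree ≤ deg f :=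
  Finset.le_sup (f := fun i => (f i).totalDegree) (Finset.mem_univ i)

theorem weight_one_eq (m : Fin n →₀ ℕ) :
    Finsupp.weight (fun _ => (1 : ℝ)) m = ((m.sum fun _ e => e : ℕ) : ℝ) := by
  rw [Finsupp.weight_apply, Finsupp.sum, Finsupp.sum]
  push_cast
  simp

theorem totalDegree_le_iff {p : MvPolynomial (Fin n) k} {d : ℕ} :
    p.totalDegree ≤ d ↔ p ∈ weightLE k (fun _ => 1) (d : ℝ) := by
  rw [mem_weightLE, totalDegree, Finset.sup_le_iff]
  simp only [weight_one_eq, mem_support_iff, Nat.cast_le]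

theorem deg_comp_le (f g : AffEnd k n) : deg (comp f g) ≤ deg f * deg g := by
  refine Finset.sup_le fun i _ => ?_
  rw [totalDegree_le_iff, mul_comm, Nat.cast_mul]
  refine aeval_mem_weightLE (Nat.cast_nonneg _) (totalDegree_le_iff.1 (totalDegree_le_deg f i))
    fun j => ?_
  rw [mul_one]
  exact totalDegree_le_iff.1 (totalDegree_le_deg g j)

theorem tendsto_const_rpow {c : ℝ} (hc : 0 < c) :
    Tendsto (fun r : ℕ => c ^ (1 / (r : ℝ))) atTop (𝓝 1) := by
  have h : Tendsto (fun r : ℕ => 1 / (r : ℝ)) atTop (𝓝 0) :=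
    tendsto_const_div_atTop_nhds_zero_nat 1
  simpa using (tendsto_const_nhds (x := c)).rpow h (Or.inl hc.ne')

theorem tendsto_const_mul_pow_rpow {c θ : ℝ} (hc : 0 < c) (hθ : 0 ≤ θ) :
    Tendsto (fun r : ℕ => (c * θ ^ r) ^ (1 / (r : ℝ))) atTop (𝓝 θ) := by
  have h := (tendsto_const_rpow hc).mul_const θ
  rw [one_mul] at h
  refine h.congr' ?_
  filter_upwards [eventually_gt_atTop 0] with r hr
  rw [Real.mul_rpow hc.le (by positivity), one_div, Real.pow_rpow_inv_natCast hθ hr.ne']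

theorem IsDynamicalDegree.le {f : AffEnd k n} {l θ c : ℝ} (hf : IsDynamicalDegree f l)
    (hc : 0 < c) (hθ : 0 ≤ θ) (h : ∀ r, (deg (iter f r) : ℝ) ≤ c * θ ^ r) : l ≤ θ :=
  le_of_tendsto_of_tendsto' hf (tendsto_const_mul_pow_rpow hc hθ) fun r =>
    Real.rpow_le_rpow (Nat.cast_nonneg _) (h r) (by positivity)

theorem IsDynamicalDegree.ge {f : AffEnd k n} {l θ c : ℝ} (hf : IsDynamicalDegree f l)
    (hc : 0 < c) (hθ : 0 ≤ θ) (h : ∀ r, c * θ ^ r ≤ (deg (iter f r) : ℝ)) : θ ≤ l :=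
  le_of_tendsto_of_tendsto' (tendsto_const_mul_pow_rpow hc hθ) hf fun r =>
    Real.rpow_le_rpow (by positivity) (h r) (by positivity)

theorem isDynamicalDegree_of_bounds {f : AffEnd k n} {θ c c' : ℝ} (hθ : 0 ≤ θ) (hc : 0 < c)
    (hc' : 0 < c') (h : ∀ r, c * θ ^ r ≤ (deg (iter f r) : ℝ))
    (h' : ∀ r, (deg (iter f r) : ℝ) ≤ c' * θ ^ r) : IsDynamicalDegree f θ :=
  tendsto_of_tendsto_of_tendsto_of_le_of_le (tendsto_const_mul_pow_rpow hc hθ)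
    (tendsto_const_mul_pow_rpow hc' hθ)
    (fun r => Real.rpow_le_rpow (by positivity) (h r) (by positivity))
    (fun r => Real.rpow_le_rpow (Nat.cast_nonneg _) (h' r) (by positivity))

/-- Conjugation by `β` changes the degree of every iterate by a factor bounded independently of `r`,
and the `r`-th root of a constant tends to 1. -/
theorem IsDynamicalDegree.conj {f : AffEnd k n} {l : ℝ} (hf : IsDynamicalDegree f l)
    {β β' : AffEnd k n} (h1 : comp β β' = one k n) (h2 : comp β' β = one k n) :
    IsDynamicalDegree (comp (comp β f) β') l := by
  set c : ℕ := deg β * deg β' + 1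
  have hc : (0 : ℝ) < c := by positivity
  have key (g : AffEnd k n) : deg (comp (comp β g) β') ≤ c * deg g := by
    have a1 := deg_comp_le (comp β g) β'
    have a2 := Nat.mul_le_mul_right (deg β') (deg_comp_le β g)
    calc _ ≤ deg β * deg g * deg β' := a1.trans a2
      _ ≤ c * deg g := by simp only [c]; nlinarith [Nat.zero_le (deg g)]
  have key' (g : AffEnd k n) : deg (comp (comp β' g) β) ≤ c * deg g := by
    have a1 := deg_comp_le (comp β' g) β
    have a2 := Nat.mul_le_mul_right (deg β) (deg_comp_le β' g)
    calc _ ≤ deg β' * deg g * deg β := a1.trans a2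
      _ ≤ c * deg g := by simp only [c]; nlinarith [Nat.zero_le (deg g)]
  have hinv (g : AffEnd k n) : comp (comp β' (comp (comp β g) β')) β = g := by
    rw [← comp_assoc, ← comp_assoc, h2, one_comp, comp_assoc, h2, comp_one]
  have hu : Tendsto (fun r : ℕ => ((c : ℝ) * deg (iter f r)) ^ (1 / (r : ℝ))) atTop (𝓝 l) := by
    have := (tendsto_const_rpow hc).mul hf
    rw [one_mul] at this
    refine this.congr fun r => ?_
    rw [Real.mul_rpow hc.le (Nat.cast_nonneg _)]
  have hl : Tendsto (fun r : ℕ => ((c : ℝ)⁻¹ * deg (iter f r)) ^ (1 / (r : ℝ))) atTop (𝓝 l) := by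
    have := (tendsto_const_rpow (inv_pos.2 hc)).mul hf
    rw [one_mul] at this
    refine this.congr fun r => ?_
    rw [Real.mul_rpow (inv_pos.2 hc).le (Nat.cast_nonneg _)]
  refine tendsto_of_tendsto_of_tendsto_of_le_of_le hl hu (fun r => ?_) (fun r => ?_)
  · refine Real.rpow_le_rpow (by positivity) ?_ (by positivity)
    rw [inv_mul_le_iff₀ hc, iter_conj h1 h2]
    have := key' (comp (comp β (iter f r)) β')
    rw [hinv] at this
    exact_mod_cast this
  · refine Real.rpow_le_rpow (by positivity) ?_ (by positivity)
    rw [iter_conj h1 h2]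
    exact_mod_cast key (iter f r)

variable {μ : Fin n → ℝ} {θ : ℝ}

theorem iter_mem_weightLE (hθ : 0 ≤ θ) {f : AffEnd k n}
    (hf : ∀ i, f i ∈ weightLE k μ (θ * μ i)) (r : ℕ) (i : Fin n) :
    iter f r i ∈ weightLE k μ (θ ^ r * μ i) := by
  induction r generalizing i with
  | zero => exact X_mem_weightLE i (by simp)
  | succ r ih =>
    rw [pow_succ, mul_assoc]
    exact aeval_mem_weightLE (by positivity) (hf i) ih

theorem iter_hasTop (hθ : 0 < θ) {f g : AffEnd k n}
    (hf : ∀ i, HasTop μ (θ * μ i) (f i) (g i)) (r : ℕ) (i : Fin n) :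
    HasTop μ (θ ^ r * μ i) (iter f r i) (iter g r i) := by
  induction r generalizing i with
  | zero => rw [pow_zero, one_mul]; exact HasTop.X i
  | succ r ih =>
    rw [pow_succ, mul_assoc]
    exact HasTop.aeval (by positivity) (hf i) ih

theorem exists_deg_iter_le (hθ : 0 ≤ θ) (hμ : ∀ i, 0 < μ i) {f : AffEnd k n}
    (hf : ∀ i, f i ∈ weightLE k μ (θ * μ i)) :
    ∃ c > 0, ∀ r, (deg (iter f r) : ℝ) ≤ c * θ ^ r := by
  -- A product of numbers in `(0, 1]` is at most each factor; this form of the minimum also covers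
  -- `n = 0`.
  obtain ⟨δ, hδ, hδμ⟩ : ∃ δ > 0, ∀ i, δ ≤ μ i := by
    refine ⟨∏ i, min (μ i) 1, Finset.prod_pos fun i _ => lt_min (hμ i) one_pos, fun i => ?_⟩
    rw [← Finset.mul_prod_erase Finset.univ _ (Finset.mem_univ i)]
    refine le_trans (mul_le_of_le_one_right (le_min (hμ i).le zero_le_one) ?_) (min_le_left _ _)
    exact Finset.prod_le_one (fun j _ => le_min (hμ j).le zero_le_one) fun j _ => min_le_right _ _
  have hs : 0 ≤ ∑ i, μ i := Finset.sum_nonneg fun i _ => (hμ i).le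
  refine ⟨(∑ i, μ i) / δ + 1, by positivity, fun r => ?_⟩
  have key : (deg (iter f r) : ℝ) * δ ≤ θ ^ r * ∑ i, μ i := by
    obtain rfl | hn := n.eq_zero_or_pos
    · simp [deg]
    have : Nonempty (Fin n) := ⟨⟨0, hn⟩⟩
    obtain ⟨i, -, hi⟩ := Finset.exists_mem_eq_sup (Finset.univ : Finset (Fin n))
      Finset.univ_nonempty fun i => (iter f r i).totalDegree
    rw [deg, hi]
    by_cases h0 : iter f r i = 0
    · rw [h0]; simp; positivity
    obtain ⟨m, hm, hmi⟩ := Finset.exists_mem_eq_sup (iter f r i).support (support_nonempty.2 h0)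
      fun s => s.sum fun _ e => e
    rw [totalDegree, hmi, ← weight_one_eq]
    calc _ ≤ Finsupp.weight μ m := by
          rw [Finsupp.weight_eq_sum, Finsupp.weight_eq_sum, Finset.sum_mul]
          refine Finset.sum_le_sum fun j _ => ?_
          rw [nsmul_eq_mul, nsmul_eq_mul, mul_one]
          exact mul_le_mul_of_nonneg_left (hδμ j) (Nat.cast_nonneg _)
      _ ≤ θ ^ r * μ i := mem_weightLE.1 (iter_mem_weightLE hθ hf r i) m (mem_support_iff.1 hm)
      _ ≤ _ := mul_le_mul_of_nonneg_left
          (Finset.single_le_sum (fun j _ => (hμ j).le) (Finset.mem_univ i)) (by positivity)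
  have h2 : (deg (iter f r) : ℝ) ≤ (∑ i, μ i) / δ * θ ^ r := by
    rw [div_mul_eq_mul_div, le_div_iff₀ hδ]; linarith
  have : 0 ≤ θ ^ r := by positivity
  linarith

/-- A monomial of the top part survives in `f^r` and has weight `θ ^ r * μ i`, while a weight is at
most the degree times the sum of all `μ j`. Zero weights are allowed here, unlike in the upper
bound. -/
theorem exists_le_deg_iter (hθ : 0 < θ) (hμ : ∀ i, 0 ≤ μ i) {f g : AffEnd k n}
    (hf : ∀ i, HasTop μ (θ * μ i) (f i) (g i)) (i : Fin n) (hi : 0 < μ i)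
    (hg : ∀ r, iter g r i ≠ 0) : ∃ c > 0, ∀ r, c * θ ^ r ≤ (deg (iter f r) : ℝ) := by
  have hs : 0 < ∑ j, μ j := Finset.sum_pos' (fun j _ => hμ j) ⟨i, Finset.mem_univ i, hi⟩
  refine ⟨μ i / ∑ j, μ j, by positivity, fun r => ?_⟩
  obtain ⟨m, hm⟩ := ne_zero_iff.1 (hg r)
  have htop := iter_hasTop hθ hf r i
  have hw := htop.1 hm
  rw [← htop.coeff_eq hw] at hm
  rw [div_mul_eq_mul_div, div_le_iff₀ hs, mul_comm (μ i), ← hw]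
  have hdeg : (m.sum fun _ e => e) ≤ deg (iter f r) :=
    (le_totalDegree (mem_support_iff.2 hm)).trans (totalDegree_le_deg _ i)
  calc _ ≤ Finsupp.weight (fun _ => (1 : ℝ)) m * ∑ j, μ j := by
        rw [Finsupp.weight_eq_sum, Finsupp.weight_eq_sum, Finset.sum_mul]
        refine Finset.sum_le_sum fun j _ => ?_
        rw [nsmul_eq_mul, nsmul_eq_mul, mul_one]
        exact mul_le_mul_of_nonneg_left
          (Finset.single_le_sum (fun j _ => hμ j) (Finset.mem_univ j)) (Nat.cast_nonneg _)
    _ ≤ _ := by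
        rw [weight_one_eq]
        exact mul_le_mul_of_nonneg_right (by exact_mod_cast hdeg) hs.le

theorem IsDynamicalDegree.le_of_weight {f : AffEnd k n} {l : ℝ} (hl : IsDynamicalDegree f l)
    (hθ : 0 ≤ θ) (hμ : ∀ i, 0 < μ i) (hf : ∀ i, f i ∈ weightLE k μ (θ * μ i)) : l ≤ θ :=
  let ⟨_, hc, h⟩ := exists_deg_iter_le hθ hμ hf
  hl.le hc hθ h

theorem IsDynamicalDegree.ge_of_weight {f g : AffEnd k n} {l : ℝ} (hl : IsDynamicalDegree f l)
    (hθ : 0 < θ) (hμ : ∀ i, 0 ≤ μ i) (hf : ∀ i, HasTop μ (θ * μ i) (f i) (g i)) (i : Fin n)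
    (hi : 0 < μ i) (hg : ∀ r, iter g r i ≠ 0) : θ ≤ l :=
  let ⟨_, hc, h⟩ := exists_le_deg_iter hθ hμ hf i hi hg
  hl.ge hc hθ.le h

theorem isDynamicalDegree_of_weight [NeZero n] {f g : AffEnd k n} (hθ : 0 < θ) (hμ : ∀ i, 0 < μ i)
    (hf : ∀ i, HasTop μ (θ * μ i) (f i) (g i)) (hg : ∀ r i, iter g r i ≠ 0) :
    IsDynamicalDegree f θ :=
  let ⟨_, hc, h⟩ := exists_le_deg_iter hθ (fun i => (hμ i).le) hf 0 (hμ 0) fun r => hg r 0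
  let ⟨_, hc', h'⟩ := exists_deg_iter_le hθ.le hμ fun i => (hf i).mem
  isDynamicalDegree_of_bounds hθ.le hc hc' h h'

end AffEnd

/-! ### Polynomials in a subset of the variables. -/

section Supported

variable {k : Type*} [Field k] {σ : Type*}

theorem aeval_congr_of_mem_supported {A : Type*} [CommSemiring A] [Algebra k A] {s : Set σ}
    {p : MvPolynomial σ k} (hp : p ∈ supported k s) (φ ψ : MvPolynomial σ k →ₐ[k] A)
    (h : ∀ i ∈ s, φ (X i) = ψ (X i)) : φ p = ψ p := by
  have : supported k s ≤ AlgHom.equalizer φ ψ := by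
    refine Algebra.adjoin_le ?_
    rintro _ ⟨i, hi, rfl⟩
    exact h i hi
  exact this hp

theorem aeval_mem_of_mem_supported {A : Type*} [CommSemiring A] [Algebra k A] {s : Set σ}
    {p : MvPolynomial σ k} (hp : p ∈ supported k s) {u : σ → A} (S : Subalgebra k A)
    (h : ∀ i ∈ s, u i ∈ S) : aeval u p ∈ S := by
  have : supported k s ≤ S.comap (aeval u) := by
    refine Algebra.adjoin_le ?_
    rintro _ ⟨i, hi, rfl⟩
    simpa using h i hi
  exact this hp

theorem C_mem_supported (c : k) (s : Set σ) : C c ∈ supported k s :=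
  Subalgebra.algebraMap_mem _ c

theorem C_mul_mem_supported {s : Set σ} (c : k) {p : MvPolynomial σ k} (hp : p ∈ supported k s) :
    C c * p ∈ supported k s :=
  mul_mem (C_mem_supported c s) hp

theorem coeff_eq_zero_of_mem_supported {s : Set σ} {p : MvPolynomial σ k} (hp : p ∈ supported k s)
    {m : σ →₀ ℕ} {i : σ} (hi : i ∉ s) (hm : m i ≠ 0) : coeff m p = 0 := by
  by_contra hne
  refine hi (mem_supported.1 hp ?_)
  exact (mem_vars_iff_mem_support _).2 ⟨m, mem_support_iff.2 hne, by simpa using hm⟩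

theorem eq_affine_of_totalDegree_le_one [Fintype σ] {p : MvPolynomial σ k}
    (hp : p.totalDegree ≤ 1) :
    p = C (coeff 0 p) + ∑ j, C (coeff (Finsupp.single j 1) p) * X j := by
  classical
  ext m
  simp only [coeff_add, coeff_sum, coeff_C_mul, coeff_C, coeff_X]
  by_cases h0 : m = 0
  · subst h0; simp [Finsupp.single_eq_zero]
  by_cases h1 : ∃ j, m = Finsupp.single j 1
  · obtain ⟨j, rfl⟩ := h1
    simp [Finsupp.single_left_inj, (Ne.symm h0)]
  · rw [if_neg (Ne.symm h0), Finset.sum_eq_zero, add_zero]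
    · by_contra hne
      have hd := (le_totalDegree (mem_support_iff.2 hne)).trans hp
      obtain ⟨j, hj⟩ := Finsupp.ne_iff.1 h0
      refine h1 ⟨j, ?_⟩
      rw [Finsupp.sum_fintype _ _ (by simp)] at hd
      rw [← Finset.add_sum_erase _ _ (Finset.mem_univ j)] at hd
      simp only [Finsupp.coe_zero, Pi.zero_apply] at hj
      have hz : ∑ x ∈ Finset.univ.erase j, m x = 0 := by omega
      rw [Finset.sum_eq_zero_iff] at hz
      ext i
      by_cases hij : i = j
      · subst hij; simp; omega
      · rw [hz i (by simp [hij]), Finsupp.single_eq_of_ne hij]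
    · intro j _
      rw [if_neg fun h => h1 ⟨j, h.symm⟩, mul_zero]

end Supported

/-! ### Triangular automorphisms and the normal form up to linear conjugation. -/

section Level

variable {k : Type*} [Field k] {n : ℕ}

theorem supported_le_supported_of_lt {i m : Fin n} (h : i < m) :
    supported k {j : Fin n | j ≤ i} ≤ supported k {j : Fin n | j < m} := by
  refine supported_mono fun j hj => ?_
  exact lt_of_le_of_lt (Set.mem_ofPred.1 hj) h

/-- `p` is the sum of a non-zero multiple of the `m`-th coordinate and a polynomial in the
previous coordinates. -/
def HasLevel (m : Fin n) (p : MvPolynomial (Fin n) k) : Prop :=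
  ∃ c : k, c ≠ 0 ∧ ∃ q ∈ supported k {j : Fin n | j < m}, p = C c * X m + q

namespace HasLevel

variable {m : Fin n} {p : MvPolynomial (Fin n) k}

theorem C_mul_add (hp : HasLevel m p) {c : k} (hc : c ≠ 0) {q : MvPolynomial (Fin n) k}
    (hq : q ∈ supported k {j : Fin n | j < m}) : HasLevel m (C c * p + q) := by
  obtain ⟨d, hd, r, hr, rfl⟩ := hp
  refine ⟨c * d, mul_ne_zero hc hd, C c * r + q, add_mem (C_mul_mem_supported c hr) hq, ?_⟩
  rw [C_mul]; ring

theorem mem (hp : HasLevel m p) : p ∈ supported k {j : Fin n | j ≤ m} := by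
  obtain ⟨d, hd, r, hr, rfl⟩ := hp
  refine add_mem (C_mul_mem_supported _ (X_mem_supported.2 (by simp))) (supported_mono ?_ hr)
  exact fun j hj => le_of_lt (Set.mem_ofPred.1 hj)

theorem lt_of_mem (hp : HasLevel m p) {m' : Fin n} (h : p ∈ supported k {j : Fin n | j < m'}) :
    m < m' := by
  obtain ⟨d, hd, r, hr, rfl⟩ := hp
  by_contra hlt
  have h1 := coeff_eq_zero_of_mem_supported h (m := Finsupp.single m 1) (i := m)
    (by simpa using hlt) (by simp)
  have h2 := coeff_eq_zero_of_mem_supported hr (m := Finsupp.single m 1) (i := m) (by simp)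
    (by simp)
  rw [coeff_add, h2, coeff_C_mul, coeff_X, if_pos rfl, mul_one, add_zero] at h1
  exact hd h1

theorem aeval (hp : HasLevel m p) {u : Fin n → MvPolynomial (Fin n) k}
    (hu : ∀ j, HasLevel j (u j)) : HasLevel m (MvPolynomial.aeval u p) := by
  obtain ⟨d, hd, r, hr, rfl⟩ := hp
  have h1 : MvPolynomial.aeval u (C d * X m + r) = C d * u m + MvPolynomial.aeval u r := by
    simp [algHom_C]
  rw [h1]
  refine (hu m).C_mul_add hd (aeval_mem_of_mem_supported hr
    (supported k {j : Fin n | j < m}) fun i hi => ?_)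
  exact supported_le_supported_of_lt (Set.mem_ofPred.1 hi) (hu i).mem

end HasLevel

/-- If `x_0, …, x_N` are polynomials in the triangular family `τ_0, …, τ_N`, then `τ_N` has
degree one in `x_N`, and `x_0, …, x_{N-1}` are polynomials in `τ_0, …, τ_{N-1}`. -/
theorem hasLevel_of_aeval_eq_X {τ g : Fin n → MvPolynomial (Fin n) k}
    (hτ : ∀ i, τ i ∈ supported k {j : Fin n | j ≤ i}) (N : Fin n)
    (h : ∀ i ≤ N, aeval (fun j => if j ≤ N then τ j else 0) (g i) = X i) :
    HasLevel N (τ N) ∧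
      ∀ i < N, aeval (fun j => if j < N then τ j else 0) (g i) = X i := by
  classical
  -- Everything is read as a polynomial in `X N`. The `τ j` with `j < N` become constants, and `τ N`
  -- becomes `P`.
  let ψ : MvPolynomial (Fin n) k →ₐ[k] Polynomial (MvPolynomial (Fin n) k) :=
    aeval fun i => if i = N then Polynomial.X else Polynomial.C (X i)
  let toC : MvPolynomial (Fin n) k →ₐ[k] Polynomial (MvPolynomial (Fin n) k) :=
    (Polynomial.CAlgHom : MvPolynomial (Fin n) k →ₐ[MvPolynomial (Fin n) k] _).restrictScalars k
  have hψC (p : MvPolynomial (Fin n) k) (hp : p ∈ supported k {j : Fin n | j < N}) :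
      ψ p = Polynomial.C p := by
    refine aeval_congr_of_mem_supported hp ψ toC fun i hi => ?_
    have hi' : i ≠ N := ne_of_lt (Set.mem_ofPred.1 hi)
    simp [ψ, toC, hi']
  set P := ψ (τ N)
  let w : Fin n → Polynomial (MvPolynomial (Fin n) k) := fun j =>
    if j < N then Polynomial.C (τ j) else if j = N then Polynomial.X else 0
  have hτC (j : Fin n) (hj : j < N) : ψ (τ j) = Polynomial.C (τ j) :=
    hψC _ (supported_le_supported_of_lt hj (hτ j))
  have hcomp (p : MvPolynomial (Fin n) k) :
      ψ (aeval (fun j => if j ≤ N then τ j else 0) p) = (aeval w p).comp P := by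
    have : ψ.comp (aeval fun j => if j ≤ N then τ j else 0) =
        ((Polynomial.aeval P).restrictScalars k).comp (aeval w) := by
      ext1 j
      simp only [AlgHom.comp_apply, aeval_X, w]
      rcases lt_trichotomy j N with hj | hj | hj
      · simp [hj, hj.le, hτC j hj]
      · simp [hj, P]
      · simp [hj.not_ge, hj.not_gt, hj.ne']
    exact DFunLike.congr_fun this p
  have heval0 (p : MvPolynomial (Fin n) k) :
      (aeval w p).eval 0 = aeval (fun j => if j < N then τ j else 0) p := by
    have : ((Polynomial.aeval (0 : (MvPolynomial (Fin n) k))).restrictScalars k).comp (aeval w) =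
        aeval (fun j => if j < N then τ j else 0) := by
      ext1 j
      simp only [AlgHom.comp_apply, aeval_X, w]
      rcases lt_trichotomy j N with hj | hj | hj
      · simp [hj]
      · simp [hj]
      · simp [hj.not_gt, hj.ne']
    exact DFunLike.congr_fun this p
  have hN : (aeval w (g N)).comp P = Polynomial.X := by
    rw [← hcomp, h N le_rfl]; simp [ψ]
  -- The variable is a composition with `P`, so both factors have degree one.
  have hdeg : (aeval w (g N)).natDegree * P.natDegree = 1 := by
    rw [← Polynomial.natDegree_comp, hN, Polynomial.natDegree_X]
  obtain ⟨hdG, hdP⟩ := mul_eq_one.1 hdeg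
  constructor
  · have hP := Polynomial.eq_X_add_C_of_natDegree_le_one hdP.le
    have hG := Polynomial.eq_X_add_C_of_natDegree_le_one hdG.le
    -- The product of the two linear coefficients is 1, and a unit of a polynomial ring over a field
    -- is a constant.
    have hu : IsUnit (P.coeff 1) := by
      rw [hG] at hN
      have := congrArg (fun q => Polynomial.coeff q 1) hN
      rw [Polynomial.add_comp, Polynomial.C_mul_comp, Polynomial.C_comp,
        Polynomial.X_comp] at this
      simp only [Polynomial.coeff_add, Polynomial.coeff_C_mul, Polynomial.coeff_X_one] at this
      rw [Polynomial.coeff_C_of_ne_zero one_ne_zero, add_zero] at this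
      exact IsUnit.of_mul_eq_one _ (by rw [mul_comm]; exact this)
    obtain ⟨c, hc, hcP⟩ := MvPolynomial.isUnit_iff_eq_C_of_isReduced.1 hu
    refine ⟨c, hc.ne_zero, P.coeff 0, ?_, ?_⟩
    · have : P.coeff 0 = aeval (fun j => if j = N then 0 else X j) (τ N) := by
        rw [Polynomial.coeff_zero_eq_eval_zero]
        have : ((Polynomial.aeval (0 : (MvPolynomial (Fin n) k))).restrictScalars k).comp ψ =
            aeval (fun j => if j = N then 0 else X j) := by
          ext1 j
          by_cases hj : j = N <;> simp [hj, ψ]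
        exact DFunLike.congr_fun this (τ N)
      rw [this]
      refine aeval_mem_of_mem_supported (hτ N) _ fun i hi => ?_
      by_cases hiN : i = N
      · simp [hiN]
      · rw [if_neg hiN]
        exact X_mem_supported.2 (lt_of_le_of_ne (Set.mem_ofPred.1 hi) hiN)
    · have : P.eval (X N) = τ N := by
        have :
            ((Polynomial.aeval (X N : MvPolynomial (Fin n) k)).restrictScalars k).comp ψ =
              AlgHom.id k (MvPolynomial (Fin n) k) := by
          ext1 j
          by_cases hj : j = N <;> simp [hj, ψ]
        exact DFunLike.congr_fun this (τ N)
      rw [← this, ← hcP]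
      conv_lhs => rw [hP]
      simp
  · intro i hi
    have hiP : (aeval w (g i)).comp P = Polynomial.C (X i) := by
      rw [← hcomp, h i hi.le]; simp [ψ, hi.ne]
    -- For `i < N` the composition with the linear `P` is constant, so `g i` does not use `τ N`,
    -- which may then be replaced by 0.
    have hd0 : (aeval w (g i)).natDegree = 0 := by
      have := congrArg Polynomial.natDegree hiP
      rwa [Polynomial.natDegree_comp, hdP, mul_one, Polynomial.natDegree_C] at this
    rw [Polynomial.eq_C_of_natDegree_eq_zero hd0, Polynomial.C_comp] at hiP
    rw [← heval0, ← Polynomial.coeff_zero_eq_eval_zero]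
    exact Polynomial.C_injective hiP

namespace AffEnd

/-- Descending induction: at the last index the cut-off is vacuous, and each step discards the last
remaining member of the family. -/
theorem hasLevel_of_isTriangular {τ g : AffEnd k n} (hτ : IsTriangular τ)
    (h : comp g τ = one k n) (i : Fin n) : HasLevel i (τ i) := by
  obtain _ | n := n
  · exact i.elim0
  have key (N : Fin (n + 1)) :
      ∀ i ≤ N, aeval (fun j => if j ≤ N then τ j else 0) (g i) = X i := by
    induction N using Fin.reverseInduction with
    | last =>
      intro i _
      simp only [Fin.le_last, if_true]
      exact congrFun h i
    | cast N ih =>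
      intro i hi
      have := (hasLevel_of_aeval_eq_X hτ N.succ ih).2 i
        (lt_of_le_of_lt hi Fin.castSucc_lt_succ)
      simpa only [Fin.le_castSucc_iff] using this
  exact (hasLevel_of_aeval_eq_X hτ i (key i)).1

/-- Invertibility of `α` forces a non-zero combination of its components to be non-constant. The
level is the largest index whose variable occurs in that affine form. -/
theorem exists_hasLevel_sum {α α' τ : AffEnd k n} (h1 : comp α α' = one k n) (hα : deg α ≤ 1)
    (hτ : ∀ i, HasLevel i (τ i)) {b : Fin n → k} (hb : b ≠ 0) :
    ∃ m, HasLevel m (∑ i, C (b i) * comp α τ i) := by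
  classical
  set A := ∑ i, C (b i) * α i with hA
  have hAd : A.totalDegree ≤ 1 := by
    rw [totalDegree_le_iff]
    exact sum_mem fun i _ => C_mul_mem_weightLE _
      (totalDegree_le_iff.1 ((totalDegree_le_deg α i).trans hα))
  have hAff := eq_affine_of_totalDegree_le_one hAd
  set c := fun j => coeff (Finsupp.single j 1) A
  have hS : ∑ i, C (b i) * comp α τ i = C (coeff 0 A) + ∑ j, C (c j) * τ j := by
    have : aeval τ A = ∑ i, C (b i) * comp α τ i := by
      simp [hA, comp, map_sum, algHom_C]
    rw [← this]
    conv_lhs => rw [hAff]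
    simp [map_sum, algHom_C, c]
  have hne : (Finset.univ.filter fun j => c j ≠ 0).Nonempty := by
    by_contra hemp
    rw [Finset.not_nonempty_iff_eq_empty, Finset.filter_eq_empty_iff] at hemp
    have h0 : A = C (coeff 0 A) := by
      conv_lhs => rw [hAff]
      rw [Finset.sum_eq_zero, add_zero]
      intro j _
      have : c j = 0 := by simpa using hemp (Finset.mem_univ j)
      simp only [c] at this
      rw [this, C_0, zero_mul]
    have h2 : aeval α' A = ∑ i, C (b i) * X i := by
      rw [hA, map_sum]
      refine Finset.sum_congr rfl fun i _ => ?_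
      rw [map_mul, algHom_C, algebraMap_eq]
      congr 1
      exact congrFun h1 i
    rw [h0, algHom_C, algebraMap_eq] at h2
    refine hb (funext fun i => ?_)
    have := congrArg (coeff (Finsupp.single i 1)) h2
    simpa [coeff_sum, coeff_C_mul, coeff_X, Finsupp.single_left_inj, coeff_C,
      Finsupp.single_eq_zero, eq_comm] using this
  set m := (Finset.univ.filter fun j => c j ≠ 0).max' hne
  have hm : c m ≠ 0 := (Finset.mem_filter.1 (Finset.max'_mem _ hne)).2
  refine ⟨m, ?_⟩
  rw [hS, ← Finset.add_sum_erase _ _ (Finset.mem_univ m), add_left_comm]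
  refine (hτ m).C_mul_add hm (add_mem (C_mem_supported _ _) (sum_mem fun j hj => ?_))
  by_cases hj0 : c j = 0
  · rw [hj0, C_0, zero_mul]; exact zero_mem _
  · have hjm : j < m :=
      lt_of_le_of_ne (Finset.le_max' _ j (by simp [hj0])) (Finset.ne_of_mem_erase hj)
    exact C_mul_mem_supported _ (supported_le_supported_of_lt hjm (hτ j).mem)

/-- Gaussian elimination: to `f i` one adds a combination of the earlier components that makes the
level as small as possible. If two minimal levels agreed, subtracting a multiple of the earlier
combination from the later one would lower its level. -/
theorem exists_unitriangular_injective_level {f : AffEnd k n}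
    (hf : ∀ b : Fin n → k, b ≠ 0 → ∃ m, HasLevel m (∑ i, C (b i) * f i)) :
    ∃ (B : Fin n → Fin n → k) (π : Fin n → Fin n), (∀ i, B i i = 1) ∧ (∀ i j, i < j → B i j = 0) ∧
      Function.Injective π ∧ ∀ i, HasLevel (π i) (∑ j, C (B i j) * f j) := by
  classical
  let S : Fin n → Set (Fin n) := fun i =>
    {m | ∃ b : Fin n → k, b i = 1 ∧ (∀ j, i < j → b j = 0) ∧ HasLevel m (∑ j, C (b j) * f j)}
  have hne (b : Fin n → k) (i : Fin n) (h : b i = 1) : b ≠ 0 := by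
    rintro rfl; simp at h
  have hS (i : Fin n) : (S i).Nonempty := by
    obtain ⟨m, hm⟩ := hf (Pi.single i 1) (hne _ i (by simp))
    exact ⟨m, _, by simp, fun j hj => by simp [hj.ne'], hm⟩
  have hmin (i : Fin n) : ∃ m ∈ S i, ∀ m' ∈ S i, m ≤ m' :=
    ⟨_, WellFounded.min_mem wellFounded_lt (S i) (hS i), fun m' hm' =>
      not_lt.1 (WellFounded.not_lt_min wellFounded_lt (S i) hm')⟩
  choose π hπ hπmin using hmin
  choose B hB1 hB2 hB3 using hπ
  refine ⟨B, π, hB1, hB2, ?_, hB3⟩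
  have key (i j : Fin n) (hji : j < i) : π i ≠ π j := by
    intro heq
    obtain ⟨c, hc, q, hq, hcq⟩ := hB3 i
    obtain ⟨c', hc', q', hq', hcq'⟩ := hB3 j
    set b' : Fin n → k := fun l => B i l - c / c' * B j l
    have hb'i : b' i = 1 := by simp [b', hB1, hB2 j i hji]
    have hsum : ∑ l, C (b' l) * f l = q - C (c / c') * q' := by
      have h1 : ∑ l, C (b' l) * f l =
          ∑ l, C (B i l) * f l - C (c / c') * ∑ l, C (B j l) * f l := by
        rw [Finset.mul_sum, ← Finset.sum_sub_distrib]
        refine Finset.sum_congr rfl fun l _ => ?_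
        simp only [b', C_sub, C_mul]; ring
      rw [h1, hcq, hcq', ← heq, mul_add, ← mul_assoc, ← C_mul, div_mul_cancel₀ _ hc']
      ring
    obtain ⟨m', hm'⟩ := hf b' (hne _ i hb'i)
    have hlt : m' < π i := by
      refine hm'.lt_of_mem ?_
      rw [hsum]
      rw [← heq] at hq'
      exact sub_mem hq (C_mul_mem_supported _ hq')
    refine absurd (hπmin i m' ⟨b', hb'i, fun l hl => ?_, hm'⟩) (not_le.2 hlt)
    simp [b', hB2 i l hl, hB2 j l (hji.trans hl)]
  intro i j hij
  rcases lt_trichotomy i j with h | h | h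
  · exact absurd hij.symm (key j i h)
  · exact h
  · exact absurd hij (key i j h)

theorem exists_conj_hasLevel {f : AffEnd k 3} (hf : IsAutomorphism f) (hf' : IsAffineTriangular f) :
    ∃ (β β' : AffEnd k 3) (π : Fin 3 → Fin 3), comp β β' = one k 3 ∧ comp β' β = one k 3 ∧
      Function.Injective π ∧ ∀ i, HasLevel (π i) (comp (comp β f) β' i) := by
  obtain ⟨α, τ, ⟨⟨α', h1, h2⟩, hdeg⟩, hτ, rfl⟩ := hf'
  obtain ⟨g, hg1, hg2⟩ := hf
  -- An inverse `g` of `α ∘ τ` yields the left inverse `g ∘ α` of `τ`.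
  have hlev := hasLevel_of_isTriangular hτ (g := comp g α) (by rw [comp_assoc, hg2])
  obtain ⟨B, π, hB1, hB2, hπ, hB⟩ := exists_unitriangular_injective_level fun b hb =>
    exists_hasLevel_sum h1 hdeg.le hlev hb
  set a := B 1 0
  set b := B 2 0
  set c := B 2 1
  -- The inverse of the lower unitriangular `B` comes from forward substitution. It is unitriangular
  -- too, so composing with it on the right preserves levels.
  refine ⟨fun i => ∑ j, C (B i j) * X j,
    ![X 0, X 1 - C a * X 0, X 2 - C b * X 0 - C c * (X 1 - C a * X 0)], π, ?_, ?_, hπ, ?_⟩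
  · funext i
    fin_cases i <;>
      simp [comp, one, Fin.sum_univ_three, hB1, hB2, algHom_C, a, b, c]
  · funext i
    fin_cases i <;>
      simp [comp, one, Fin.sum_univ_three, hB1, hB2, algHom_C, a, b, c]
    ring
  · intro i
    have : comp (fun i => ∑ j, C (B i j) * X j) (comp α τ) i = ∑ j, C (B i j) * comp α τ j := by
      simp only [comp, map_sum, map_mul, algHom_C, algebraMap_eq, aeval_X]
    rw [comp, this]
    refine (hB i).aeval fun j => ?_
    have hX (i j : Fin 3) (h : j < i) : (X j : MvPolynomial (Fin 3) k) ∈ supported k {l | l < i} :=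
      X_mem_supported.2 h
    fin_cases j
    · exact ⟨1, one_ne_zero, 0, zero_mem _, by simp⟩
    · refine ⟨1, one_ne_zero, - (C a * X 0),
        neg_mem (C_mul_mem_supported _ (hX _ _ (by decide))), ?_⟩
      simp; ring
    · refine ⟨1, one_ne_zero, - (C b * X 0) - C c * (X 1 - C a * X 0), ?_, ?_⟩
      · exact sub_mem (neg_mem (C_mul_mem_supported _ (hX _ _ (by decide))))
          (C_mul_mem_supported _ (sub_mem (hX _ _ (by decide))
            (C_mul_mem_supported _ (hX _ _ (by decide)))))
      · simp; ring

end AffEnd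

end Level

/-! ### Algebraic independence, for the non-vanishing of iterated top parts. -/

section Injectivity

variable {k : Type*} [Field k] {σ τ : Type*}

theorem eq_zero_of_mem_supported_empty {u : σ → MvPolynomial τ k} {p : MvPolynomial σ k}
    (hp : p ∈ supported k (∅ : Set σ)) (h : aeval u p = 0) : p = 0 := by
  rw [supported_empty, Algebra.mem_bot] at hp
  obtain ⟨c, rfl⟩ := hp
  rw [AlgHom.commutes, algebraMap_eq, C_eq_zero] at h
  rw [h, map_zero]

/-- If the polynomials `u i`, `i ∈ s`, do not involve the variable `t` and are algebraically
independent, and `u a` involves `t`, then the `u i`, `i ∈ insert a s`, are algebraically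
independent. -/
theorem eq_zero_of_mem_supported_insert {s : Set σ} {a : σ} {t : τ} {u : σ → MvPolynomial τ k}
    (hs : ∀ p ∈ supported k s, aeval u p = 0 → p = 0)
    (hu : ∀ i ∈ s, u i ∈ supported k {t}ᶜ) (ha : u a ∉ supported k {t}ᶜ)
    {p : MvPolynomial σ k} (hp : p ∈ supported k (insert a s)) (h : aeval u p = 0) : p = 0 := by
  classical
  let ψ : MvPolynomial τ k →ₐ[k] Polynomial (MvPolynomial τ k) :=
    aeval fun i => if i = t then Polynomial.X else Polynomial.C (X i)
  have hψC (q : MvPolynomial τ k) (hq : q ∈ supported k {t}ᶜ) : ψ q = Polynomial.C q := by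
    refine aeval_congr_of_mem_supported hq ψ
      ((Polynomial.CAlgHom : MvPolynomial τ k →ₐ[MvPolynomial τ k] _).restrictScalars k)
      fun i hi => ?_
    have hi' : i ≠ t := hi
    simp [ψ, hi']
  let χ : MvPolynomial σ k →ₐ[k] Polynomial (MvPolynomial σ k) :=
    aeval fun i => if i = a then Polynomial.X else Polynomial.C (X i)
  have has (i : σ) (hi : i ∈ s) : i ≠ a := by
    rintro rfl
    exact ha (hu i hi)
  -- With `p` read as a polynomial in `X a` and the target as polynomials in `X t`, substitution
  -- becomes composition with `u a`. A composition vanishes only if the outer polynomial does, or if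
  -- `u a` is constant in `X t`, which `ha` forbids.
  have hcomp : ψ (aeval u p) =
      ((χ p).map (aeval u : MvPolynomial σ k →ₐ[k] MvPolynomial τ k).toRingHom).comp
        (ψ (u a)) := by
    let φ : MvPolynomial σ k →ₐ[k] Polynomial (MvPolynomial τ k) :=
      (((Polynomial.aeval (ψ (u a))).restrictScalars k).comp
        (Polynomial.mapAlgHom (aeval u : MvPolynomial σ k →ₐ[k] MvPolynomial τ k))).comp χ
    change ψ.comp (aeval u) p = φ p
    refine aeval_congr_of_mem_supported hp _ _ fun i hi => ?_
    rcases Set.mem_insert_iff.1 hi with rfl | hi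
    · simp [φ, χ]
    · simp [φ, χ, has i hi, hψC _ (hu i hi)]
  rw [h, map_zero, eq_comm, Polynomial.comp_eq_zero_iff] at hcomp
  have hχ : χ p = 0 := by
    have hmem : χ p ∈ (Polynomial.mapAlgHom (supported k s).val).range := by
      refine aeval_mem_of_mem_supported hp _ fun i hi => ?_
      rcases Set.mem_insert_iff.1 hi with rfl | hi
      · exact ⟨Polynomial.X, by simp⟩
      · exact ⟨Polynomial.C ⟨X i, X_mem_supported.2 hi⟩, by simp [has i hi]⟩
    obtain ⟨P, hP⟩ := hmem
    rcases hcomp with h0 | ⟨-, h0⟩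
    · ext1 j
      rw [Polynomial.coeff_zero]
      have h1 : (χ p).coeff j ∈ supported k s := by
        rw [← hP]
        simp
      refine hs _ h1 ?_
      have := congrArg (fun q => Polynomial.coeff q j) h0
      simpa [Polynomial.coeff_map] using this
    · refine absurd ?_ ha
      have h1 : u a = (ψ (u a)).coeff 0 := by
        have : ((Polynomial.aeval (X t : MvPolynomial τ k)).restrictScalars k).comp ψ =
            AlgHom.id k (MvPolynomial τ k) := by
          ext1 j
          by_cases hj : j = t <;> simp [hj, ψ]
        have h2 := DFunLike.congr_fun this (u a)
        rw [AlgHom.comp_apply, h0] at h2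
        simpa using h2.symm
      have h2 : (ψ (u a)).coeff 0 = aeval (fun j => if j = t then 0 else X j) (u a) := by
        rw [Polynomial.coeff_zero_eq_eval_zero]
        have : ((Polynomial.aeval (0 : MvPolynomial τ k)).restrictScalars k).comp ψ =
            aeval (fun j => if j = t then 0 else X j) := by
          ext1 j
          by_cases hj : j = t <;> simp [hj, ψ]
        exact DFunLike.congr_fun this (u a)
      rw [h1, h2]
      refine aeval_mem_of_mem_supported (s := Set.univ) (by simp) _ fun i _ => ?_
      by_cases hi : i = t
      · simp [hi]
      · rw [if_neg hi]
        exact X_mem_supported.2 hi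
  have hback : ((Polynomial.aeval (X a : MvPolynomial σ k)).restrictScalars k).comp χ =
      AlgHom.id k (MvPolynomial σ k) := by
    ext1 j
    by_cases hj : j = a <;> simp [hj, χ]
  have := DFunLike.congr_fun hback p
  rw [AlgHom.comp_apply, hχ, map_zero] at this
  exact this.symm

theorem eq_zero_of_mem_supported_singleton {a : σ} {t : τ} {u : σ → MvPolynomial τ k}
    (ha : u a ∉ supported k {t}ᶜ) {p : MvPolynomial σ k} (hp : p ∈ supported k {a})
    (h : aeval u p = 0) : p = 0 :=
  eq_zero_of_mem_supported_insert (s := ∅) (fun _ => eq_zero_of_mem_supported_empty) (by simp) ha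
    (by simpa using hp) h

theorem notMem_supported_compl {t : τ} {p : MvPolynomial τ k} {m : τ →₀ ℕ} (hm : coeff m p ≠ 0)
    (ht : m t ≠ 0) : p ∉ supported k {t}ᶜ := fun h =>
  hm (coeff_eq_zero_of_mem_supported h (by simp) ht)

theorem C_mul_X_pow_notMem_supported_compl {t : τ} {c : k} (hc : c ≠ 0) {d : ℕ} (hd : d ≠ 0) :
    C c * X t ^ d ∉ supported k {t}ᶜ := by
  classical
  refine notMem_supported_compl (m := Finsupp.single t d) ?_ (by simpa using hd)
  rw [coeff_C_mul, coeff_X_pow, if_pos rfl, mul_one]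
  exact hc

theorem exists_polynomial_of_mem_supported_singleton {i : σ} {p : MvPolynomial σ k}
    (hp : p ∈ supported k {i}) : ∃ P : Polynomial k, Polynomial.aeval (X i) P = p := by
  rw [supported, Set.image_singleton, Algebra.adjoin_singleton_eq_range_aeval] at hp
  exact hp

end Injectivity

/-! ### Weights of polynomials in one variable. -/

section UnivariateWeights

variable {k : Type*} [Field k] {n : ℕ} {μ : Fin n → ℝ} {s : ℝ}

theorem C_mul_X_pow_mem_weightLE (i : Fin n) (c : k) {j : ℕ} (h : j * μ i ≤ s) :
    C c * X i ^ j ∈ weightLE k μ s :=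
  C_mul_mem_weightLE c (weightLE_mono h ((HasTop.X i).pow j).mem)

theorem C_mul_X_mem_weightLE (i : Fin n) (c : k) (h : μ i ≤ s) :
    C c * X i ∈ weightLE k μ s :=
  C_mul_mem_weightLE c (X_mem_weightLE i h)

theorem C_mul_X_mem_weightLT (i : Fin n) (c : k) (h : μ i < s) :
    C c * X i ∈ weightLT k μ s :=
  weightLE_le_weightLT h (C_mul_X_mem_weightLE i c le_rfl)

theorem aeval_X_mem_weightLE {i : Fin n} (hi : 0 ≤ μ i) (P : Polynomial k)
    (h : P.natDegree * μ i ≤ s) : Polynomial.aeval (X i) P ∈ weightLE k μ s := by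
  rw [Polynomial.aeval_eq_sum_range]
  refine sum_mem fun j hj => ?_
  rw [smul_eq_C_mul]
  refine C_mul_X_pow_mem_weightLE i _ (le_trans ?_ h)
  refine mul_le_mul_of_nonneg_right ?_ hi
  exact_mod_cast Nat.lt_succ_iff.1 (Finset.mem_range.1 hj)

theorem hasTop_aeval_X {i : Fin n} (hi : 0 < μ i) (P : Polynomial k) :
    HasTop μ (P.natDegree * μ i) (Polynomial.aeval (X i) P)
      (C P.leadingCoeff * X i ^ P.natDegree) := by
  rw [Polynomial.aeval_eq_sum_range, Finset.sum_range_succ, ← zero_add (C _ * _)]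
  refine HasTop.add (HasTop.of_lt (sum_mem fun j hj => ?_)) ?_
  · rw [smul_eq_C_mul]
    refine weightLE_le_weightLT ?_ (C_mul_X_pow_mem_weightLE i _ le_rfl)
    refine mul_lt_mul_of_pos_right ?_ hi
    exact_mod_cast Finset.mem_range.1 hj
  · rw [smul_eq_C_mul]
    exact ((HasTop.X i).pow _).C_mul _

theorem hasTop_C_mul_X_add_C {i : Fin n} (hi : 0 < μ i) (c d : k) :
    HasTop μ (μ i) (C c * X i + C d) (C c * X i) := by
  have := ((HasTop.X (μ := μ) i).C_mul c).add (HasTop.of_lt (C_mem_weightLT d hi))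
  rwa [add_zero] at this

end UnivariateWeights

namespace AffEnd

variable {k : Type*} [Field k] {n : ℕ}

theorem iter_succ' (f : AffEnd k n) (r : ℕ) : iter f (r + 1) = comp (iter f r) f := by
  induction r with
  | zero =>
    change comp f (one k n) = comp (one k n) f
    rw [comp_one, one_comp]
  | succ r ih => rw [iter, ih, ← comp_assoc, ← iter, ih]

/-- Writing `g^(r+1)` as `g^r ∘ g`, each step is a substitution that is injective on the polynomials
in the variables of `s`. The other components of `g` are irrelevant and may vanish. -/
theorem iter_ne_zero {g : AffEnd k n} {s : Set (Fin n)} (hs : ∀ i ∈ s, g i ∈ supported k s)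
    (hg : ∀ p ∈ supported k s, aeval g p = 0 → p = 0) {i : Fin n} (hi : i ∈ s) (r : ℕ) :
    iter g r i ≠ 0 := by
  have : iter g r i ∈ supported k s ∧ iter g r i ≠ 0 := by
    induction r with
    | zero => exact ⟨X_mem_supported.2 hi, X_ne_zero i⟩
    | succ r ih =>
      rw [iter_succ']
      exact ⟨aeval_mem_of_mem_supported ih.1 _ hs, fun h => ih.2 (hg _ ih.1 h)⟩
  exact this.2

end AffEnd

/-! ### Choice of weights in dimension three. -/

section ThreeVariables

variable {k : Type*} [Field k] {a b c s : ℝ} {Q : MvPolynomial (Fin 3) k}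

theorem weight_vec_three (a b c : ℝ) (m : Fin 3 →₀ ℕ) :
    Finsupp.weight ![a, b, c] m = m 0 * a + m 1 * b + m 2 * c := by
  simp [Finsupp.weight_eq_sum, Fin.sum_univ_three]

theorem apply_two_eq_zero (hQ : Q ∈ supported k {0, 1}) {m : Fin 3 →₀ ℕ} (hm : coeff m Q ≠ 0) :
    m 2 = 0 := by
  by_contra h
  exact hm (coeff_eq_zero_of_mem_supported hQ (by decide) h)

theorem mem_weightLE_of_mem_supported (hQ : Q ∈ supported k {0, 1}) :
    Q ∈ weightLE k ![a, b, c] s ↔ ∀ m, coeff m Q ≠ 0 → m 0 * a + m 1 * b ≤ s := by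
  rw [mem_weightLE]
  refine forall₂_congr fun m hm => ?_
  rw [weight_vec_three, apply_two_eq_zero hQ hm, Nat.cast_zero, zero_mul, add_zero]

theorem apply_zero_add_apply_one_le {m : Fin 3 →₀ ℕ} (hm : coeff m Q ≠ 0) :
    m 0 + m 1 ≤ Q.totalDegree := by
  have h := le_totalDegree (mem_support_iff.2 hm)
  rw [Finsupp.sum_fintype _ _ (fun _ => rfl), Fin.sum_univ_three] at h
  omega

theorem mem_weightLE_of_totalDegree (hQ : Q ∈ supported k {0, 1}) (ha : 0 ≤ a) (hb : 0 ≤ b)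
    (h : Q.totalDegree * (a + b) ≤ s) : Q ∈ weightLE k ![a, b, c] s := by
  rw [mem_weightLE_of_mem_supported hQ]
  intro m hm
  have h1 : ((m 0 : ℝ) + m 1) ≤ Q.totalDegree := by exact_mod_cast apply_zero_add_apply_one_le hm
  have h2 := mul_le_mul_of_nonneg_right h1 (add_nonneg ha hb)
  have h3 : (0 : ℝ) ≤ m 0 * b := by positivity
  have h4 : (0 : ℝ) ≤ m 1 * a := by positivity
  linarith

/-- Each monomial `m` determines the non-negative root `t m` of `t ^ 2 = m 0 * t + m 1 * d`. The
largest of these roots is `θ`: its monomial attains equality, and the others satisfy the inequality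
because `θ` lies beyond their roots. -/
theorem exists_root_of_support (Q : MvPolynomial (Fin 3) k) {d : ℕ} {m₁ : Fin 3 →₀ ℕ}
    (hm₁ : coeff m₁ Q ≠ 0) (h : 2 ≤ m₁ 0 + m₁ 1 * d) :
    ∃ θ : ℝ, 1 < θ ∧ (∀ m, coeff m Q ≠ 0 → m 0 * θ + m 1 * d ≤ θ ^ 2) ∧
      ∃ m, coeff m Q ≠ 0 ∧ m 0 * θ + m 1 * d = θ ^ 2 := by
  let t : (Fin 3 →₀ ℕ) → ℝ := fun m => (m 0 + √((m 0 : ℝ) ^ 2 + 4 * (m 1 * d))) / 2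
  have ht (m : Fin 3 →₀ ℕ) : t m ^ 2 = m 0 * t m + m 1 * d := by
    have := Real.sq_sqrt (show 0 ≤ (m 0 : ℝ) ^ 2 + 4 * (m 1 * d) by positivity)
    simp only [t]
    linear_combination this / 4
  have ht0 (m : Fin 3 →₀ ℕ) : (m 0 : ℝ) ≤ t m := by
    have := Real.le_sqrt_of_sq_le
      (show (m 0 : ℝ) ^ 2 ≤ (m 0 : ℝ) ^ 2 + 4 * (m 1 * d) by
        have : (0 : ℝ) ≤ m 1 * d := by positivity
        linarith)
    simp only [t]
    linarith
  obtain ⟨m, hm, hmax⟩ := Finset.exists_max_image Q.support t ⟨m₁, mem_support_iff.2 hm₁⟩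
  have h1 : 1 < t m₁ := by
    by_contra hle
    have h2 : (2 : ℝ) ≤ m₁ 0 + m₁ 1 * d := by exact_mod_cast h
    nlinarith [ht m₁, ht0 m₁, Nat.cast_nonneg (α := ℝ) (m₁ 0)]
  refine ⟨t m, h1.trans_le (hmax m₁ (mem_support_iff.2 hm₁)), fun m' hm' => ?_, m,
    mem_support_iff.1 hm, (ht m).symm⟩
  have h2 := hmax m' (mem_support_iff.2 hm')
  have h3 : (0 : ℝ) ≤ t m := (Nat.cast_nonneg _).trans (ht0 m)
  nlinarith [ht m', ht0 m', mul_nonneg (sub_nonneg.2 h2) h3,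
    mul_nonneg (sub_nonneg.2 h2) (sub_nonneg.2 (ht0 m'))]

end ThreeVariables

/-! ### Dynamical degrees of the normal forms. -/

namespace AffEnd

/-- `l` is at most one, or a root of `x ^ 2 - a x - b` with natural numbers `a` and `b`. -/
def LeOneOrQuadratic (l : ℝ) : Prop :=
  l ≤ 1 ∨ ∃ a b : ℕ, l ^ 2 = a * l + b

theorem LeOneOrQuadratic.of_natCast {l : ℝ} (a : ℕ) (h : l = a) : LeOneOrQuadratic l :=
  Or.inr ⟨a, 0, by rw [h]; push_cast; ring⟩

variable {k : Type*} [Field k] {f : AffEnd k 3} {l : ℝ}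

/-- If each variable weighs enough compared with the previous ones, no component weighs more than
its own variable, and `θ = 1` works. -/
theorem IsDynamicalDegree.le_one_of_triangular (hl : IsDynamicalDegree f l) {c₀ d₀ c₁ c₂ : k}
    {P : Polynomial k} {Q : MvPolynomial (Fin 3) k} (hQ : Q ∈ supported k {0, 1})
    (h0 : f 0 = C c₀ * X 0 + C d₀) (h1 : f 1 = C c₁ * X 1 + Polynomial.aeval (X 0) P)
    (h2 : f 2 = C c₂ * X 2 + Q) : l ≤ 1 := by
  refine hl.le_of_weight (μ := ![1, P.natDegree + 1, (Q.totalDegree + 1) * (1 + (P.natDegree + 1))])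
    zero_le_one ?_ ?_
  · intro i
    fin_cases i
    · exact zero_lt_one
    · change (0 : ℝ) < P.natDegree + 1; positivity
    · change (0 : ℝ) < (Q.totalDegree + 1) * (1 + (P.natDegree + 1)); positivity
  · intro i
    rw [one_mul]
    fin_cases i
    · change f 0 ∈ weightLE k _ 1
      rw [h0]
      exact add_mem (C_mul_X_mem_weightLE _ _ le_rfl) (C_mem_weightLE _ zero_le_one)
    · change f 1 ∈ weightLE k _ (P.natDegree + 1)
      rw [h1]
      refine add_mem (C_mul_X_mem_weightLE _ _ le_rfl) (aeval_X_mem_weightLE zero_le_one _ ?_)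
      simp
    · change f 2 ∈ weightLE k _ ((Q.totalDegree + 1) * (1 + (P.natDegree + 1)))
      rw [h2]
      refine add_mem (C_mul_X_mem_weightLE _ _ le_rfl) (mem_weightLE_of_totalDegree hQ zero_le_one
        (by positivity) ?_)
      have : (0 : ℝ) ≤ P.natDegree := Nat.cast_nonneg _
      nlinarith

/-- The first two coordinates form a Hénon-type map governed by the degree of `P`; the third
variable is made heavy enough to absorb `Q`. -/
theorem IsDynamicalDegree.leOneOrQuadratic_of_planar (hl : IsDynamicalDegree f l)
    {c₀ d₀ c₁ c₂ : k} {P : Polynomial k} {Q : MvPolynomial (Fin 3) k}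
    (hQ : Q ∈ supported k {0, 1}) (h0 : f 0 = C c₁ * X 1 + Polynomial.aeval (X 0) P)
    (h1 : f 1 = C c₀ * X 0 + C d₀) (h2 : f 2 = C c₂ * X 2 + Q) : LeOneOrQuadratic l := by
  have hD : (0 : ℝ) ≤ Q.totalDegree := Nat.cast_nonneg _
  rcases le_or_gt P.natDegree 1 with hP | hP
  · left
    refine hl.le_of_weight (μ := ![1, 1, (Q.totalDegree + 1) * (1 + 1)]) zero_le_one ?_ ?_
    · intro i
      fin_cases i
      · exact zero_lt_one
      · exact zero_lt_one
      · change (0 : ℝ) < (Q.totalDegree + 1) * (1 + 1); positivity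
    · intro i
      rw [one_mul]
      fin_cases i
      · change f 0 ∈ weightLE k _ 1
        rw [h0]
        refine add_mem (C_mul_X_mem_weightLE _ _ le_rfl) (aeval_X_mem_weightLE zero_le_one _ ?_)
        simpa using hP
      · change f 1 ∈ weightLE k _ 1
        rw [h1]
        exact add_mem (C_mul_X_mem_weightLE _ _ le_rfl) (C_mem_weightLE _ zero_le_one)
      · change f 2 ∈ weightLE k _ ((Q.totalDegree + 1) * (1 + 1))
        rw [h2]
        refine add_mem (C_mul_X_mem_weightLE _ _ le_rfl) (mem_weightLE_of_totalDegree hQ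
          zero_le_one zero_le_one ?_)
        linarith
  · set δ := P.natDegree
    have hδ : (1 : ℝ) < δ := by exact_mod_cast hP
    have hδ0 : (0 : ℝ) < δ := zero_lt_one.trans hδ
    set μ : Fin 3 → ℝ := ![δ, 1, (Q.totalDegree + 1) * (δ + 1)] with hμ
    have hμpos (i : Fin 3) : 0 < μ i := by
      fin_cases i
      · exact hδ0
      · exact zero_lt_one
      · change (0 : ℝ) < (Q.totalDegree + 1) * (δ + 1); positivity
    have hf2 : f 2 ∈ weightLE k μ (δ * ((Q.totalDegree + 1) * (δ + 1))) := by
      rw [h2]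
      have h3 : (0 : ℝ) ≤ (Q.totalDegree + 1) * (δ + 1) := by positivity
      refine add_mem (C_mul_X_mem_weightLE _ _ ?_) (mem_weightLE_of_totalDegree hQ
        hδ0.le zero_le_one ?_)
      · change (Q.totalDegree + 1) * ((δ : ℝ) + 1) ≤ _
        nlinarith
      · nlinarith
    have htop (i : Fin 3) : HasTop μ (δ * μ i) (f i) ((![C P.leadingCoeff * X 0 ^ δ, C c₀ * X 0,
        weightedHomogeneousComponent μ (δ * ((Q.totalDegree + 1) * (δ + 1))) (f 2)] :
          Fin 3 → MvPolynomial (Fin 3) k) i) := by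
      fin_cases i
      · change HasTop μ (δ * δ) (f 0) (C P.leadingCoeff * X 0 ^ δ)
        rw [h0, ← zero_add (C P.leadingCoeff * X 0 ^ δ)]
        refine HasTop.add (HasTop.of_lt (C_mul_X_mem_weightLT _ _ ?_)) (hasTop_aeval_X hδ0 P)
        change (1 : ℝ) < δ * δ
        nlinarith
      · change HasTop μ (δ * 1) (f 1) (C c₀ * X 0)
        rw [h1, mul_one]
        exact hasTop_C_mul_X_add_C hδ0 _ _
      · exact HasTop.of_mem hf2
    have hP0 : P.leadingCoeff ≠ 0 := by
      rw [Polynomial.leadingCoeff_ne_zero]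
      rintro rfl
      simp [δ] at hP
    refine LeOneOrQuadratic.of_natCast δ (le_antisymm ?_ ?_)
    · exact hl.le_of_weight hδ0.le hμpos fun i => (htop i).mem
    · refine hl.ge_of_weight hδ0 (fun i => (hμpos i).le) htop 0 (hμpos 0)
        (iter_ne_zero (s := {0}) ?_ ?_ rfl)
      · rintro i rfl
        exact C_mul_mem_supported _ (pow_mem (X_mem_supported.2 (by simp)) _)
      · intro p hp h
        refine eq_zero_of_mem_supported_singleton (a := 0) (t := 0) ?_ hp h
        exact C_mul_X_pow_notMem_supported_compl hP0 (by omega)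

/-- The case where the second coordinate has no growth. -/
theorem IsDynamicalDegree.leOneOrQuadratic_of_fibration (hl : IsDynamicalDegree f l)
    {c₁ d₁ c c₂ : k} (hc₁ : c₁ ≠ 0) {P : Polynomial k} {Q : MvPolynomial (Fin 3) k}
    (hQ : Q ∈ supported k {0, 1}) (h0 : f 0 = C c * X 2 + Q)
    (h1 : f 1 = C c₁ * X 1 + C d₁) (h2 : f 2 = C c₂ * X 0 + Polynomial.aeval (X 1) P) :
    LeOneOrQuadratic l := by
  set e := Q.degreeOf 0
  have he (m : Fin 3 →₀ ℕ) (hm : coeff m Q ≠ 0) : m 0 ≤ e :=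
    monomial_le_degreeOf 0 (mem_support_iff.2 hm)
  have hupper (ε : ℝ) (hε : 0 < ε) : l ≤ max (e : ℝ) 1 + ε := by
    set θ := max (e : ℝ) 1 + ε with hθdef
    have hθ1 : 1 ≤ θ := by
      have := le_max_right (e : ℝ) 1
      linarith
    have hθe : e + ε ≤ θ := by
      have := le_max_left (e : ℝ) 1
      linarith
    -- With weights `(M, 1, M)` a monomial of `Q` weighs at most `e * M + Q.totalDegree`, hence at
    -- most `(e + ε) * M`; the second summand of `M` absorbs `P`.
    set M : ℝ := (Q.totalDegree + 1) / ε + P.natDegree with hM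
    have hMpos : 0 < M := by positivity
    have hMQ : (Q.totalDegree : ℝ) ≤ ε * M := by
      rw [hM, mul_add, mul_div_cancel₀ _ hε.ne']
      have : 0 ≤ ε * P.natDegree := by positivity
      linarith
    have hMP : (P.natDegree : ℝ) ≤ M := by
      rw [hM]
      have : 0 ≤ ((Q.totalDegree : ℝ) + 1) / ε := by positivity
      linarith
    have hMθ : M ≤ θ * M := le_mul_of_one_le_left hMpos.le hθ1
    refine hl.le_of_weight (μ := ![M, 1, M]) (by linarith) ?_ ?_
    · intro i
      fin_cases i
      · exact hMpos
      · exact zero_lt_one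
      · exact hMpos
    · intro i
      fin_cases i
      · change f 0 ∈ weightLE k _ (θ * M)
        rw [h0]
        refine add_mem (C_mul_X_mem_weightLE _ _ hMθ) ((mem_weightLE_of_mem_supported hQ).2 ?_)
        intro m hm
        have h3 : (m 0 : ℝ) ≤ e := by exact_mod_cast he m hm
        have h4 : (m 1 : ℝ) ≤ Q.totalDegree := by
          exact_mod_cast (Nat.le_add_left _ _).trans (apply_zero_add_apply_one_le hm)
        nlinarith
      · change f 1 ∈ weightLE k _ (θ * 1)
        rw [h1, mul_one]
        exact add_mem (C_mul_X_mem_weightLE _ _ hθ1) (C_mem_weightLE _ (by linarith))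
      · change f 2 ∈ weightLE k _ (θ * M)
        rw [h2]
        refine add_mem (C_mul_X_mem_weightLE _ _ hMθ) (aeval_X_mem_weightLE zero_le_one _ ?_)
        change _ * (1 : ℝ) ≤ _
        linarith
  have hle : l ≤ max (e : ℝ) 1 := le_of_forall_pos_le_add hupper
  rcases Nat.lt_or_ge e 2 with he2 | he2
  · left
    rwa [max_eq_right (by exact_mod_cast Nat.lt_succ_iff.1 he2)] at hle
  have he1 : (1 : ℝ) < e := by exact_mod_cast he2
  have he0 : (0 : ℝ) < e := zero_lt_one.trans he1
  rw [max_eq_left he1.le] at hle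
  refine LeOneOrQuadratic.of_natCast e (le_antisymm hle ?_)
  -- For the lower bound the second variable may weigh 0. The top part of `f 0` is then `X 0 ^ e`
  -- times a polynomial in `X 1`, without the loss of `ε`.
  set μ : Fin 3 → ℝ := ![e, 0, 1] with hμ
  have hμpos (i : Fin 3) : 0 ≤ μ i := by
    fin_cases i
    · exact he0.le
    · exact le_rfl
    · exact zero_le_one
  have hQmem : Q ∈ weightLE k μ (e * e) := by
    refine (mem_weightLE_of_mem_supported hQ).2 fun m hm => ?_
    have h3 : (m 0 : ℝ) ≤ e := by exact_mod_cast he m hm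
    nlinarith
  set G := weightedHomogeneousComponent μ ((e : ℝ) * e) Q with hG
  have hf2 : f 2 ∈ weightLE k μ (e * 1) := by
    rw [h2, mul_one]
    refine add_mem (C_mul_X_mem_weightLE _ _ le_rfl) (aeval_X_mem_weightLE le_rfl _ ?_)
    change _ * (0 : ℝ) ≤ _
    linarith
  have hcoeff (m : Fin 3 →₀ ℕ) (hm : coeff m G ≠ 0) : coeff m Q ≠ 0 ∧ m 0 = e := by
    classical
    rw [hG, coeff_weightedHomogeneousComponent] at hm
    split_ifs at hm with hw
    · refine ⟨hm, ?_⟩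
      rw [weight_vec_three, apply_two_eq_zero hQ hm] at hw
      have : ((m 0 : ℝ)) = e := mul_right_cancel₀ he0.ne' (by simpa using hw)
      exact_mod_cast this
    · exact absurd rfl hm
  have htop (i : Fin 3) : HasTop μ (e * μ i) (f i) ((![G, C c₁ * X 1 + C d₁,
      weightedHomogeneousComponent μ (e * 1) (f 2)] : Fin 3 → MvPolynomial (Fin 3) k) i) := by
    fin_cases i
    · change HasTop μ (e * e) (f 0) G
      rw [h0, ← zero_add G]
      refine HasTop.add (HasTop.of_lt (C_mul_X_mem_weightLT _ _ ?_)) (HasTop.of_mem hQmem)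
      change (1 : ℝ) < e * e
      nlinarith
    · change HasTop μ (e * 0) (f 1) (C c₁ * X 1 + C d₁)
      rw [h1, mul_zero]
      exact ((HasTop.X (μ := μ) 1).C_mul c₁).add
        (HasTop.of_homogeneous (isWeightedHomogeneous_C _ _))
    · exact HasTop.of_mem hf2
  obtain ⟨m, hm, hme⟩ : ∃ m, coeff m Q ≠ 0 ∧ m 0 = e := by
    have hQ0 : Q.support.Nonempty := by
      rw [support_nonempty]
      rintro rfl
      simp [e] at he2
    obtain ⟨m, hm, hme⟩ := Finset.exists_mem_eq_sup Q.support hQ0 fun m => m 0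
    exact ⟨m, mem_support_iff.1 hm, by rw [← hme, ← degreeOf_eq_sup]⟩
  have hmG : coeff m G ≠ 0 := by
    classical
    rw [hG, coeff_weightedHomogeneousComponent, if_pos]
    · exact hm
    · rw [weight_vec_three, apply_two_eq_zero hQ hm, hme]
      simp
  refine hl.ge_of_weight he0 hμpos htop 0 he0 (iter_ne_zero (s := {0, 1}) ?_ ?_ (by simp))
  · rintro i (rfl | rfl)
    · refine mem_supported.2 fun i hi => ?_
      obtain ⟨m', hm', hi'⟩ := (mem_vars_iff_mem_support _).1 hi
      have hmQ := (hcoeff m' (mem_support_iff.1 hm')).1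
      by_contra hni
      exact hmQ (coeff_eq_zero_of_mem_supported hQ hni (Finsupp.mem_support_iff.1 hi'))
    · exact add_mem (C_mul_mem_supported _ (X_mem_supported.2 (by simp))) (C_mem_supported _ _)
  · intro p hp h
    refine eq_zero_of_mem_supported_insert (s := {1}) (a := 0) (t := 0) (fun q hq hq0 =>
      eq_zero_of_mem_supported_singleton (t := 1) ?_ hq hq0) ?_ ?_ hp h
    · refine notMem_supported_compl (m := Finsupp.single 1 1) ?_ (by simp)
      change coeff _ (C c₁ * X 1 + C d₁) ≠ 0
      simpa [coeff_C, Finsupp.single_eq_zero, eq_comm] using hc₁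
    · rintro i rfl
      exact add_mem (C_mul_mem_supported _ (X_mem_supported.2 (by simp))) (C_mem_supported _ _)
    · exact notMem_supported_compl hmG (by omega)

/-- The case where the growth is governed by a monomial of the first component. -/
theorem IsDynamicalDegree.eq_of_weights (hl : IsDynamicalDegree f l) {c e : k} (he : e ≠ 0)
    {Q : MvPolynomial (Fin 3) k} (hQ : Q ∈ supported k {0, 1}) (h0 : f 0 = C c * X 2 + Q)
    {d : ℕ} (hd : 1 ≤ d) {θ ν : ℝ} (hθ : 1 < θ) (hν : 0 < ν) (hνθ : ν < θ ^ 2)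
    (hQθ : ∀ m, coeff m Q ≠ 0 → m 0 * θ + m 1 * d ≤ θ ^ 2)
    {m : Fin 3 →₀ ℕ} (hm : coeff m Q ≠ 0) (hmθ : m 0 * θ + m 1 * d = θ ^ 2)
    (h1 : HasTop ![θ, d, ν] (θ * d) (f 1) (C e * X 0 ^ d))
    (h2 : f 2 ∈ weightLE k ![θ, d, ν] (θ * ν)) : l = θ := by
  have hθ0 : 0 < θ := zero_lt_one.trans hθ
  have hd0 : (0 : ℝ) < d := by exact_mod_cast hd
  set μ : Fin 3 → ℝ := ![θ, d, ν] with hμ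
  have hμpos (i : Fin 3) : 0 < μ i := by
    fin_cases i
    · exact hθ0
    · exact hd0
    · exact hν
  have hQmem : Q ∈ weightLE k μ (θ * θ) :=
    (mem_weightLE_of_mem_supported hQ).2 fun m hm => by rw [← sq]; exact hQθ m hm
  set G := weightedHomogeneousComponent μ (θ * θ) Q with hG
  have hcoeff (m : Fin 3 →₀ ℕ) (hm : coeff m G ≠ 0) :
      coeff m Q ≠ 0 ∧ m 0 * θ + m 1 * d = θ * θ := by
    classical
    rw [hG, coeff_weightedHomogeneousComponent] at hm
    split_ifs at hm with hw
    · refine ⟨hm, ?_⟩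
      rw [weight_vec_three, apply_two_eq_zero hQ hm] at hw
      simpa using hw
    · exact absurd rfl hm
  have hmG : coeff m G ≠ 0 := by
    classical
    rw [hG, coeff_weightedHomogeneousComponent, if_pos]
    · exact hm
    · rw [weight_vec_three, apply_two_eq_zero hQ hm, ← sq, ← hmθ]
      simp
  have hGs : G ∈ supported k {0, 1} := by
    refine mem_supported.2 fun i hi => ?_
    obtain ⟨m', hm', hi'⟩ := (mem_vars_iff_mem_support _).1 hi
    have hmQ := (hcoeff m' (mem_support_iff.1 hm')).1
    by_contra hni
    exact hmQ (coeff_eq_zero_of_mem_supported hQ hni (Finsupp.mem_support_iff.1 hi'))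
  have htop (i : Fin 3) : HasTop μ (θ * μ i) (f i) ((![G, C e * X 0 ^ d,
      weightedHomogeneousComponent μ (θ * ν) (f 2)] : Fin 3 → MvPolynomial (Fin 3) k) i) := by
    fin_cases i
    · change HasTop μ (θ * θ) (f 0) G
      rw [h0, ← zero_add G]
      refine HasTop.add (HasTop.of_lt (C_mul_X_mem_weightLT _ _ ?_)) (HasTop.of_mem hQmem)
      rw [← sq]
      exact hνθ
    · exact h1
    · exact HasTop.of_mem h2
  refine le_antisymm (hl.le_of_weight hθ0.le hμpos fun i => (htop i).mem)
    (hl.ge_of_weight hθ0 (fun i => (hμpos i).le) htop 0 hθ0 ?_)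
  -- If `G` does not involve `X 1`, it is a non-constant polynomial in `X 0` alone. Otherwise `G`
  -- and `X 0 ^ d` are algebraically independent.
  by_cases hG1 : G ∈ supported k {1}ᶜ
  · have hG0 (m' : Fin 3 →₀ ℕ) (hm' : coeff m' G ≠ 0) : m' 1 = 0 := by
      by_contra hne
      exact notMem_supported_compl hm' hne hG1
    refine iter_ne_zero (s := {0}) ?_ ?_ rfl
    · rintro i rfl
      refine mem_supported.2 fun i hi => ?_
      have h3 := mem_supported.1 hGs hi
      have h4 := mem_supported.1 hG1 hi
      rcases h3 with h3 | h3
      · exact h3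
      · exact absurd h3 h4
    · intro p hp h
      refine eq_zero_of_mem_supported_singleton (a := 0) (t := 0) (?_ : G ∉ _) hp h
      refine notMem_supported_compl hmG ?_
      intro h3
      have h4 := (hcoeff m hmG).2
      rw [hG0 m hmG, h3] at h4
      simp at h4
      exact hθ0.ne' h4
  · refine iter_ne_zero (s := {0, 1}) ?_ ?_ (by simp)
    · rintro i (rfl | rfl)
      · exact hGs
      · exact C_mul_mem_supported _ (pow_mem (X_mem_supported.2 (by simp)) _)
    · intro p hp h
      rw [Set.pair_comm] at hp
      refine eq_zero_of_mem_supported_insert (s := {1}) (a := 0) (t := 1) (fun q hq hq0 =>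
        eq_zero_of_mem_supported_singleton (t := 0) ?_ hq hq0) ?_ hG1
        (by rwa [Set.pair_comm] at hp) h
      · exact C_mul_X_pow_notMem_supported_compl he (by omega)
      · rintro i rfl
        exact C_mul_mem_supported _ (pow_mem (X_mem_supported.2 (by simp)) _)

/-- The weights are required for every `θ ≥ 1` because `θ` is dictated by `Q`: it is the root given
by `exists_root_of_support`, or 1 when all monomials of `Q` satisfy `m 0 + m 1 * d ≤ 1`. -/
theorem IsDynamicalDegree.leOneOrQuadratic_of_weights (hl : IsDynamicalDegree f l) {c e : k}
    (he : e ≠ 0) {Q : MvPolynomial (Fin 3) k} (hQ : Q ∈ supported k {0, 1})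
    (h0 : f 0 = C c * X 2 + Q) {d : ℕ} (hd : 1 ≤ d)
    (h : ∀ θ : ℝ, 1 ≤ θ → ∃ ν > 0, ν ≤ θ ^ 2 ∧ f 1 ∈ weightLE k ![θ, d, ν] (θ * d) ∧
      f 2 ∈ weightLE k ![θ, d, ν] (θ * ν) ∧
      (1 < θ → ν < θ ^ 2 ∧ HasTop ![θ, d, ν] (θ * d) (f 1) (C e * X 0 ^ d))) :
    LeOneOrQuadratic l := by
  by_cases hbig : ∃ m, coeff m Q ≠ 0 ∧ 2 ≤ m 0 + m 1 * d
  · obtain ⟨m₁, hm₁, h2⟩ := hbig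
    obtain ⟨θ, hθ, hQθ, m, hm, hmθ⟩ := exists_root_of_support Q hm₁ h2
    obtain ⟨ν, hν, -, -, hf2, h3⟩ := h θ hθ.le
    obtain ⟨hνθ, hf1⟩ := h3 hθ
    have := hl.eq_of_weights he hQ h0 hd hθ hν hνθ hQθ hm hmθ hf1 hf2
    exact Or.inr ⟨m 0, m 1 * d, by rw [this, ← hmθ]; push_cast; rfl⟩
  · left
    push Not at hbig
    obtain ⟨ν, hν, hν1, hf1, hf2, -⟩ := h 1 le_rfl
    refine hl.le_of_weight (μ := ![1, d, ν]) zero_le_one ?_ ?_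
    · intro i
      fin_cases i
      · exact zero_lt_one
      · change (0 : ℝ) < d
        exact_mod_cast hd
      · exact hν
    · intro i
      fin_cases i
      · change f 0 ∈ weightLE k ![1, d, ν] (1 * 1)
        rw [h0]
        refine add_mem (C_mul_X_mem_weightLE _ _ ?_) ((mem_weightLE_of_mem_supported hQ).2 ?_)
        · change ν ≤ 1 * 1
          linarith
        · intro m hm
          have := hbig m hm
          rw [mul_one, mul_one]
          exact_mod_cast Nat.lt_succ_iff.1 this
      · exact hf1
      · exact hf2

/-- The weights are `(θ, 1, θ⁻¹)`, each variable being `θ` times as heavy as the next. -/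
theorem IsDynamicalDegree.leOneOrQuadratic_of_shift (hl : IsDynamicalDegree f l)
    {c c₀ d₀ c₁ d₁ : k} (hc₀ : c₀ ≠ 0) {Q : MvPolynomial (Fin 3) k} (hQ : Q ∈ supported k {0, 1})
    (h0 : f 0 = C c * X 2 + Q) (h1 : f 1 = C c₀ * X 0 + C d₀) (h2 : f 2 = C c₁ * X 1 + C d₁) :
    LeOneOrQuadratic l := by
  refine hl.leOneOrQuadratic_of_weights hc₀ hQ h0 le_rfl fun θ hθ => ?_
  have hθ0 : 0 < θ := by linarith
  have htop : HasTop ![θ, (1 : ℕ), θ⁻¹] (θ * (1 : ℕ)) (f 1) (C c₀ * X 0 ^ 1) := by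
    rw [h1, Nat.cast_one, mul_one, pow_one]
    exact hasTop_C_mul_X_add_C (μ := ![θ, 1, θ⁻¹]) (i := 0) hθ0 _ _
  refine ⟨θ⁻¹, inv_pos.2 hθ0, ?_, htop.mem, ?_, fun hθ1 => ⟨?_, htop⟩⟩
  · exact (inv_le_one_of_one_le₀ hθ).trans (by nlinarith)
  · rw [h2, mul_inv_cancel₀ hθ0.ne']
    exact add_mem (C_mul_X_mem_weightLE _ _ (by simp)) (C_mem_weightLE _ zero_le_one)
  · exact (inv_lt_one_of_one_lt₀ hθ1).trans (by nlinarith)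

/-- The weights are `(θ, deg P, 1)`, so that the leading term of `P` is the top part of `f 1`; a
constant `P` falls under the fibration case. -/
theorem IsDynamicalDegree.leOneOrQuadratic_of_reversal (hl : IsDynamicalDegree f l)
    {c c₀ d₀ c₁ : k} (hc₁ : c₁ ≠ 0) {P : Polynomial k} {Q : MvPolynomial (Fin 3) k}
    (hQ : Q ∈ supported k {0, 1}) (h0 : f 0 = C c * X 2 + Q)
    (h1 : f 1 = C c₁ * X 1 + Polynomial.aeval (X 0) P) (h2 : f 2 = C c₀ * X 0 + C d₀) :
    LeOneOrQuadratic l := by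
  rcases Nat.eq_zero_or_pos P.natDegree with hP | hP
  · rw [Polynomial.eq_C_of_natDegree_eq_zero hP, Polynomial.aeval_C, algebraMap_eq] at h1
    refine hl.leOneOrQuadratic_of_fibration hc₁ (c₂ := c₀) (P := Polynomial.C d₀) hQ h0 h1 ?_
    rw [h2, Polynomial.aeval_C, algebraMap_eq]
  have hP0 : P.leadingCoeff ≠ 0 := by
    rw [Polynomial.leadingCoeff_ne_zero]
    rintro rfl
    simp at hP
  have hd : (0 : ℝ) < P.natDegree := by exact_mod_cast hP
  refine hl.leOneOrQuadratic_of_weights hP0 hQ h0 hP fun θ hθ => ?_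
  have hθ0 : 0 < θ := by linarith
  have htop := hasTop_aeval_X (μ := ![θ, P.natDegree, 1]) (i := 0) hθ0 P
  change HasTop _ (P.natDegree * θ) _ _ at htop
  rw [mul_comm] at htop
  refine ⟨1, one_pos, one_le_pow₀ hθ, ?_, ?_, fun hθ1 => ⟨one_lt_pow₀ hθ1 two_ne_zero, ?_⟩⟩
  · rw [h1]
    refine add_mem (C_mul_X_mem_weightLE _ _ ?_) htop.mem
    change (P.natDegree : ℝ) ≤ _
    nlinarith
  · rw [h2, mul_one]
    exact add_mem (C_mul_X_mem_weightLE _ _ le_rfl) (C_mem_weightLE _ hθ0.le)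
  · rw [h1, ← zero_add (C P.leadingCoeff * _)]
    refine (HasTop.of_lt (C_mul_X_mem_weightLT _ _ ?_)).add htop
    change (P.natDegree : ℝ) < _
    nlinarith

end AffEnd

/-! ### The six permutations of the levels. -/

section LevelThree

variable {k : Type*} [Field k] {p : MvPolynomial (Fin 3) k}

theorem HasLevel.exists_eq_zero (h : HasLevel 0 p) :
    ∃ c d : k, c ≠ 0 ∧ p = C c * X 0 + C d := by
  obtain ⟨c, hc, q, hq, rfl⟩ := h
  have : {j : Fin 3 | j < 0} = ∅ := by ext j; simp
  rw [this, supported_empty, Algebra.mem_bot] at hq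
  obtain ⟨d, rfl⟩ := hq
  exact ⟨c, d, hc, rfl⟩

theorem HasLevel.exists_eq_one (h : HasLevel 1 p) :
    ∃ (c : k) (P : Polynomial k), c ≠ 0 ∧ p = C c * X 1 + Polynomial.aeval (X 0) P := by
  obtain ⟨c, hc, q, hq, rfl⟩ := h
  have : {j : Fin 3 | j < 1} = {0} := by ext j; fin_cases j <;> simp
  rw [this] at hq
  obtain ⟨P, rfl⟩ := exists_polynomial_of_mem_supported_singleton hq
  exact ⟨c, P, hc, rfl⟩

theorem HasLevel.exists_eq_two (h : HasLevel 2 p) :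
    ∃ (c : k), ∃ q ∈ supported k {0, 1}, c ≠ 0 ∧ p = C c * X 2 + q := by
  obtain ⟨c, hc, q, hq, rfl⟩ := h
  have : {j : Fin 3 | j < 2} = {0, 1} := by ext j; fin_cases j <;> simp
  rw [this] at hq
  exact ⟨c, q, hq, hc, rfl⟩

theorem injective_fin_three_cases : ∀ π : Fin 3 → Fin 3, Function.Injective π →
    (π 0 = 0 ∧ π 1 = 1 ∧ π 2 = 2) ∨ (π 0 = 0 ∧ π 1 = 2 ∧ π 2 = 1) ∨
    (π 0 = 1 ∧ π 1 = 0 ∧ π 2 = 2) ∨ (π 0 = 1 ∧ π 1 = 2 ∧ π 2 = 0) ∨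
    (π 0 = 2 ∧ π 1 = 0 ∧ π 2 = 1) ∨ (π 0 = 2 ∧ π 1 = 1 ∧ π 2 = 0) := by
  decide

end LevelThree

namespace AffEnd

variable {k : Type*} [Field k] {f : AffEnd k 3} {l : ℝ}

theorem bind₁_polynomial_aeval {n : ℕ} (u : AffEnd k n) (p : MvPolynomial (Fin n) k)
    (P : Polynomial k) : bind₁ u (Polynomial.aeval p P) = Polynomial.aeval (bind₁ u p) P :=
  (Polynomial.aeval_algHom_apply (bind₁ u) p P).symm

theorem IsDynamicalDegree.leOneOrQuadratic_of_hasLevel (hl : IsDynamicalDegree f l)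
    {π : Fin 3 → Fin 3} (hπ : Function.Injective π) (hf : ∀ i, HasLevel (π i) (f i)) :
    LeOneOrQuadratic l := by
  have H0 := hf 0
  have H1 := hf 1
  have H2 := hf 2
  rcases injective_fin_three_cases π hπ with ⟨e0, e1, e2⟩ | ⟨e0, e1, e2⟩ | ⟨e0, e1, e2⟩ |
    ⟨e0, e1, e2⟩ | ⟨e0, e1, e2⟩ | ⟨e0, e1, e2⟩ <;> rw [e0] at H0 <;> rw [e1] at H1 <;>
    rw [e2] at H2
  · obtain ⟨c₀, d₀, -, h0⟩ := H0.exists_eq_zero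
    obtain ⟨c₁, P, -, h1⟩ := H1.exists_eq_one
    obtain ⟨c₂, Q, hQ, -, h2⟩ := H2.exists_eq_two
    exact Or.inl (hl.le_one_of_triangular hQ h0 h1 h2)
  · obtain ⟨c₀, d₀, hc₀, h0⟩ := H0.exists_eq_zero
    obtain ⟨c₁, P, -, h1⟩ := H2.exists_eq_one
    obtain ⟨c₂, Q, hQ, -, h2⟩ := H1.exists_eq_two
    -- Exchanging the first two variables leads to the fibration case.
    let β : AffEnd k 3 := ![X 1, X 0, X 2]
    have hβ : comp β β = one k 3 := by
      funext i
      fin_cases i <;> simp [comp, one, β]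
    refine (hl.conj hβ hβ).leOneOrQuadratic_of_fibration (c₁ := c₀) (d₁ := d₀) (c := c₂)
      (c₂ := c₁) (P := P) (Q := aeval β Q) hc₀ ?_ ?_ ?_ ?_
    · refine aeval_mem_of_mem_supported hQ _ ?_
      rintro i (rfl | rfl) <;> exact X_mem_supported.2 (by simp)
    · simp [comp, β, h2, algHom_C]
    · simp [comp, β, h0, algHom_C]
    · simp [comp, β, h1, algHom_C, bind₁_polynomial_aeval]
  · obtain ⟨c₀, d₀, -, h0⟩ := H1.exists_eq_zero
    obtain ⟨c₁, P, -, h1⟩ := H0.exists_eq_one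
    obtain ⟨c₂, Q, hQ, -, h2⟩ := H2.exists_eq_two
    exact hl.leOneOrQuadratic_of_planar hQ h1 h0 h2
  · obtain ⟨c₀, d₀, -, h0⟩ := H2.exists_eq_zero
    obtain ⟨c₁, P, hc₁, h1⟩ := H0.exists_eq_one
    obtain ⟨c₂, Q, hQ, -, h2⟩ := H1.exists_eq_two
    -- The new coordinates are `(f 0, X 0, X 2)`. In them the second component of the map is the
    -- first coordinate, as in the shift case.
    let β : AffEnd k 3 := ![C c₁ * X 1 + Polynomial.aeval (X 0) P, X 0, X 2]
    let β' : AffEnd k 3 := ![X 1, C c₁⁻¹ * (X 0 - Polynomial.aeval (X 1) P), X 2]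
    have hcc : (C c₁ : MvPolynomial (Fin 3) k) * C c₁⁻¹ = 1 := by
      rw [← C_mul, mul_inv_cancel₀ hc₁, C_1]
    have hβ : comp β β' = one k 3 := by
      funext i
      fin_cases i
      · simp [comp, one, β, β', algHom_C, bind₁_polynomial_aeval, ← mul_assoc, hcc]
      · simp [comp, one, β, β']
      · simp [comp, one, β, β']
    have hβ' : comp β' β = one k 3 := by
      funext i
      fin_cases i
      · simp [comp, one, β, β']
      · simp [comp, one, β, β', algHom_C, bind₁_polynomial_aeval]
        rw [← mul_assoc, mul_comm (C c₁⁻¹), hcc, one_mul]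
      · simp [comp, one, β, β']
    have hfβ : aeval β' (f 0) = X 0 := by
      rw [h1]
      exact congrFun hβ 0
    refine (hl.conj hβ hβ').leOneOrQuadratic_of_shift (c := c₁ * c₂) (c₀ := 1) (d₀ := 0)
      (c₁ := c₀) (d₁ := d₀) (Q := C c₁ * aeval β' Q + Polynomial.aeval (X 0) P) one_ne_zero
      ?_ ?_ ?_ ?_
    · have hX0 : (X 0 : MvPolynomial (Fin 3) k) ∈ supported k {0, 1} :=
        X_mem_supported.2 (by simp)
      have hX1 : (X 1 : MvPolynomial (Fin 3) k) ∈ supported k {0, 1} :=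
        X_mem_supported.2 (by simp)
      have hP (x : MvPolynomial (Fin 3) k) (hx : x ∈ supported k {0, 1}) :
          Polynomial.aeval x P ∈ supported k {0, 1} :=
        Algebra.adjoin_le (Set.singleton_subset_iff.2 hx)
          (Polynomial.aeval_mem_adjoin_singleton k x)
      refine add_mem (C_mul_mem_supported _ (aeval_mem_of_mem_supported hQ _ ?_)) (hP _ hX0)
      rintro i (rfl | rfl)
      · exact hX1
      · exact C_mul_mem_supported _ (sub_mem hX0 (hP _ hX1))
    · have : comp (comp β f) β' 0 =
          C c₁ * aeval β' (f 1) + Polynomial.aeval (aeval β' (f 0)) P := by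
        simp [comp, β, algHom_C, bind₁_polynomial_aeval]
      rw [this, hfβ, h2]
      simp [β', algHom_C]
      ring
    · have : comp (comp β f) β' 1 = aeval β' (f 0) := by simp [comp, β]
      rw [this, hfβ]
      simp
    · simp [comp, β, β', h0, algHom_C]
  · obtain ⟨c₀, d₀, hc₀, h0⟩ := H1.exists_eq_zero
    obtain ⟨c₁, P, -, h1⟩ := H2.exists_eq_one
    obtain ⟨c₂, Q, hQ, -, h2⟩ := H0.exists_eq_two
    -- `R` is chosen so that `R (f 1) = P (X 0)`; replacing `X 2` by `X 2 - R (X 1)` then removes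
    -- `P` from the last component.
    let R : Polynomial k := P.comp (Polynomial.C c₀⁻¹ * (Polynomial.X - Polynomial.C d₀))
    have hR (x : MvPolynomial (Fin 3) k) :
        Polynomial.aeval (C c₀ * x + C d₀) R = Polynomial.aeval x P := by
      have hcc : (C c₀⁻¹ : MvPolynomial (Fin 3) k) * C c₀ = 1 := by
        rw [← C_mul, inv_mul_cancel₀ hc₀, C_1]
      rw [Polynomial.aeval_comp]
      congr 1
      simp [algebraMap_eq, ← mul_assoc, hcc]
    let β : AffEnd k 3 := ![X 0, X 1, X 2 - Polynomial.aeval (X 1) R]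
    let β' : AffEnd k 3 := ![X 0, X 1, X 2 + Polynomial.aeval (X 1) R]
    have hβ : comp β β' = one k 3 := by
      funext i
      fin_cases i <;> simp [comp, one, β, β', bind₁_polynomial_aeval]
    have hβ' : comp β' β = one k 3 := by
      funext i
      fin_cases i <;> simp [comp, one, β, β', bind₁_polynomial_aeval]
    refine (hl.conj hβ hβ').leOneOrQuadratic_of_shift (c := c₂) (c₀ := c₀) (d₀ := d₀)
      (c₁ := c₁) (d₁ := 0) (Q := C c₂ * Polynomial.aeval (X 1) R + aeval β' Q) hc₀
      ?_ ?_ ?_ ?_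
    · have hX0 : (X 0 : MvPolynomial (Fin 3) k) ∈ supported k {0, 1} :=
        X_mem_supported.2 (by simp)
      have hX1 : (X 1 : MvPolynomial (Fin 3) k) ∈ supported k {0, 1} :=
        X_mem_supported.2 (by simp)
      refine add_mem (C_mul_mem_supported _ (Algebra.adjoin_le (Set.singleton_subset_iff.2 hX1)
        (Polynomial.aeval_mem_adjoin_singleton k _))) (aeval_mem_of_mem_supported hQ _ ?_)
      rintro i (rfl | rfl)
      · exact hX0
      · exact hX1
    · simp [comp, β, β', h2, algHom_C]
      ring
    · simp [comp, β, β', h0, algHom_C]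
    · have : comp (comp β f) β' 2 =
          aeval β' (f 2) - Polynomial.aeval (aeval β' (f 1)) R := by
        simp [comp, β, bind₁_polynomial_aeval]
      have h3 : aeval β' (f 1) = C c₀ * X 0 + C d₀ := by
        simp [β', h0, algHom_C]
      rw [this, h3, hR, h1]
      simp [β', algHom_C, bind₁_polynomial_aeval]
  · obtain ⟨c₀, d₀, -, h0⟩ := H2.exists_eq_zero
    obtain ⟨c₁, P, hc₁, h1⟩ := H1.exists_eq_one
    obtain ⟨c₂, Q, hQ, -, h2⟩ := H0.exists_eq_two
    exact hl.leOneOrQuadratic_of_reversal hc₁ hQ h2 h1 h0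

theorem IsDynamicalDegree.leOneOrQuadratic (hl : IsDynamicalDegree f l) (hf : IsAutomorphism f)
    (hf' : IsAffineTriangular f) : LeOneOrQuadratic l := by
  obtain ⟨β, β', π, h1, h2, hπ, hlev⟩ := exists_conj_hasLevel hf hf'
  exact (hl.conj h1 h2).leOneOrQuadratic_of_hasLevel hπ hlev

end AffEnd

/-! ### Arithmetic of quadratic weak Perron numbers. -/

section QuadraticWeakPerron

variable {l : ℝ} {a b : ℤ}

theorem sq_eq_of_minpoly_eq (hmin : minpoly ℚ l =
    Polynomial.X ^ 2 - Polynomial.C (a : ℚ) * Polynomial.X - Polynomial.C (b : ℚ)) :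
    l ^ 2 = a * l + b := by
  have h := minpoly.aeval ℚ l
  rw [hmin] at h
  simp at h
  linarith

theorem ne_ratCast_of_minpoly_eq (hmin : minpoly ℚ l =
    Polynomial.X ^ 2 - Polynomial.C (a : ℚ) * Polynomial.X - Polynomial.C (b : ℚ)) (q : ℚ) :
    l ≠ q := by
  rintro rfl
  have h := congrArg Polynomial.natDegree hmin
  have h1 : minpoly ℚ (q : ℝ) = Polynomial.X - Polynomial.C q := minpoly.eq_X_sub_C ℝ q
  have h2 : (Polynomial.X ^ 2 - Polynomial.C (a : ℚ) * Polynomial.X -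
      Polynomial.C (b : ℚ)).natDegree = 2 := by compute_degree!
  rw [h1, h2, Polynomial.natDegree_X_sub_C] at h
  omega

/-- The other root of the minimal polynomial is `a - l`. -/
theorem IsWeakPerron.abs_sub_le (hl : IsWeakPerron l) (hmin : minpoly ℚ l =
    Polynomial.X ^ 2 - Polynomial.C (a : ℚ) * Polynomial.X - Polynomial.C (b : ℚ)) :
    |(a : ℝ) - l| ≤ l := by
  have h1 := sq_eq_of_minpoly_eq hmin
  have h2 := hl.2.2 (((a : ℝ) - l : ℝ) : ℂ) (by
    rw [hmin]
    simp only [map_sub, map_pow, map_mul, Polynomial.aeval_X, Polynomial.aeval_C]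
    have h3 : ((a : ℝ) - l) ^ 2 - a * (a - l) - b = 0 := by linear_combination h1
    have h4 := congrArg (fun x : ℝ => (x : ℂ)) h3
    push_cast at h4
    simpa using h4)
  rwa [Complex.norm_real, Real.norm_eq_abs] at h2

/-- Two different linear coefficients would let one solve for `l` as a rational number. -/
theorem eq_of_sq_eq (hmin : minpoly ℚ l =
    Polynomial.X ^ 2 - Polynomial.C (a : ℚ) * Polynomial.X - Polynomial.C (b : ℚ))
    (h : l ^ 2 = a * l + b) {a' b' : ℤ} (h' : l ^ 2 = a' * l + b') : b = b' := by
  by_cases haa : a = a'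
  · subst haa
    have : (b : ℝ) = b' := by linarith
    exact_mod_cast this
  · exfalso
    have hne : (a : ℝ) - a' ≠ 0 := sub_ne_zero.2 (by exact_mod_cast haa)
    refine ne_ratCast_of_minpoly_eq hmin (((b' - b : ℤ) : ℚ) / ((a - a' : ℤ) : ℚ)) ?_
    push_cast
    rw [eq_div_iff hne]
    linarith

end QuadraticWeakPerron

/-! ### The explicit automorphisms in dimensions three and four. -/

namespace AffEnd

variable {k : Type*} [Field k]

theorem isDynamicalDegree_shift {l : ℝ} (hl : 1 < l) {A B : ℕ} (h : l ^ 2 = A * l + B) :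
    IsDynamicalDegree (![X 2 + X 0 ^ A * X 1 ^ B, X 0, X 1] : AffEnd k 3) l := by
  have hl0 : 0 < l := zero_lt_one.trans hl
  refine isDynamicalDegree_of_weight (μ := ![l ^ 2, l, 1]) (g := ![X 0 ^ A * X 1 ^ B, X 0, X 1])
    hl0 ?_ ?_ ?_
  · intro i
    fin_cases i
    · exact pow_pos hl0 2
    · exact hl0
    · exact zero_lt_one
  · intro i
    fin_cases i
    · change HasTop _ (l * l ^ 2) (X 2 + X 0 ^ A * X 1 ^ B) (X 0 ^ A * X 1 ^ B)
      rw [← zero_add (X 0 ^ A * X 1 ^ B), ← add_assoc, add_zero]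
      refine HasTop.add (HasTop.of_lt (weightLE_le_weightLT ?_ (X_mem_weightLE 2 le_rfl))) ?_
      · change 1 < l * l ^ 2
        nlinarith
      · convert ((HasTop.X (k := k) (μ := ![l ^ 2, l, 1]) 0).pow A).mul
          ((HasTop.X (k := k) (μ := ![l ^ 2, l, 1]) 1).pow B) using 1
        change l * l ^ 2 = A * l ^ 2 + B * l
        linear_combination l * h
    · change HasTop _ (l * l) (X 0) (X 0)
      rw [← sq]
      exact HasTop.X 0
    · change HasTop _ (l * 1) (X 1) (X 1)
      rw [mul_one]
      exact HasTop.X 1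
  · intro r
    induction r with
    | zero => exact fun i => X_ne_zero i
    | succ r ih =>
      intro i
      fin_cases i
      · simpa [iter, comp] using ⟨fun h => absurd h (ih 0), fun h => absurd h (ih 1)⟩
      · simpa [iter, comp] using ih 0
      · simpa [iter, comp] using ih 1

theorem isAutomorphism_shift (A B : ℕ) :
    IsAutomorphism (![X 2 + X 0 ^ A * X 1 ^ B, X 0, X 1] : AffEnd k 3) := by
  refine ⟨![X 1, X 2, X 0 - X 1 ^ A * X 2 ^ B], ?_, ?_⟩ <;> funext i <;> fin_cases i <;>
    simp [comp, one]

theorem isShiftLike_shift (A B : ℕ) :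
    IsShiftLike (![X 2 + X 0 ^ A * X 1 ^ B, X 0, X 1] : AffEnd k 3) := by
  refine ⟨X 0 ^ A * X 1 ^ B, ?_⟩
  funext i
  fin_cases i
  · simp
  · rfl
  · rfl

/-- Hypothesis `h` makes `(1, l - α)` an eigenvector of the exponent matrix with eigenvalue `l`. The
last two variables carry these weights, and the first two carry `l` times them. -/
theorem isDynamicalDegree_double_shift {l : ℝ} (hl : 1 < l) {α β γ : ℕ} (hα : α < l)
    (h : (l - α) * (l - γ) = β) :
    IsDynamicalDegree
      (![X 2 + X 0 ^ α * X 1 ^ 1, X 3 + X 0 ^ β * X 1 ^ γ, X 0, X 1] : AffEnd k 4) l := by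
  have hl0 : 0 < l := zero_lt_one.trans hl
  have hv : 0 < l - α := sub_pos.2 hα
  set μ : Fin 4 → ℝ := ![l, l * (l - α), 1, l - α]
  refine isDynamicalDegree_of_weight (μ := μ)
    (g := ![X 0 ^ α * X 1 ^ 1, X 0 ^ β * X 1 ^ γ, X 0, X 1]) hl0 ?_ ?_ ?_
  · intro i
    fin_cases i
    · exact hl0
    · exact mul_pos hl0 hv
    · exact zero_lt_one
    · exact hv
  · intro i
    fin_cases i
    · change HasTop _ (l * l) (X 2 + X 0 ^ α * X 1 ^ 1) (X 0 ^ α * X 1 ^ 1)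
      rw [← zero_add (X 0 ^ α * X 1 ^ 1), ← add_assoc, add_zero]
      refine HasTop.add (HasTop.of_lt (weightLE_le_weightLT ?_ (X_mem_weightLE 2 le_rfl))) ?_
      · change 1 < l * l
        nlinarith
      · convert ((HasTop.X (k := k) (μ := μ) 0).pow α).mul
          ((HasTop.X (k := k) (μ := μ) 1).pow 1) using 1
        change l * l = α * l + (1 : ℕ) * (l * (l - α))
        push_cast
        ring
    · change HasTop _ (l * (l * (l - α))) (X 3 + X 0 ^ β * X 1 ^ γ) (X 0 ^ β * X 1 ^ γ)
      rw [← zero_add (X 0 ^ β * X 1 ^ γ), ← add_assoc, add_zero]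
      refine HasTop.add (HasTop.of_lt (weightLE_le_weightLT ?_ (X_mem_weightLE 3 le_rfl))) ?_
      · change l - α < l * (l * (l - α))
        have : 1 < l * l := by nlinarith
        nlinarith
      · convert ((HasTop.X (k := k) (μ := μ) 0).pow β).mul
          ((HasTop.X (k := k) (μ := μ) 1).pow γ) using 1
        change l * (l * (l - α)) = β * l + γ * (l * (l - α))
        linear_combination l * h
    · change HasTop _ (l * 1) (X 0) (X 0)
      rw [mul_one]
      exact HasTop.X 0
    · exact HasTop.X 1
  · intro r
    induction r with
    | zero => exact fun i => X_ne_zero i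
    | succ r ih =>
      intro i
      rw [pow_one] at ih ⊢
      fin_cases i
      · simpa [iter, comp] using ⟨fun h => absurd h (ih 0), ih 1⟩
      · simpa [iter, comp] using ⟨fun h => absurd h (ih 0), fun h => absurd h (ih 1)⟩
      · simpa [iter, comp] using ih 0
      · simpa [iter, comp] using ih 1

theorem isAutomorphism_double_shift (α β γ δ : ℕ) :
    IsAutomorphism
      (![X 2 + X 0 ^ α * X 1 ^ β, X 3 + X 0 ^ γ * X 1 ^ δ, X 0, X 1] : AffEnd k 4) := by
  refine ⟨![X 2, X 3, X 0 - X 2 ^ α * X 3 ^ β, X 1 - X 2 ^ γ * X 3 ^ δ], ?_, ?_⟩ <;> funext i <;>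
    fin_cases i <;> simp [comp, one]

theorem isPermutationTriangular_double_shift (α β γ δ : ℕ) :
    IsPermutationTriangular
      (![X 2 + X 0 ^ α * X 1 ^ β, X 3 + X 0 ^ γ * X 1 ^ δ, X 0, X 1] : AffEnd k 4) := by
  refine ⟨fun i => X ((![2, 3, 0, 1] : Fin 4 → Fin 4) i),
    ![X 0, X 1, X 2 + X 0 ^ α * X 1 ^ β, X 3 + X 0 ^ γ * X 1 ^ δ], ?_, ?_, ?_⟩
  · have : Function.Surjective (![2, 3, 0, 1] : Fin 4 → Fin 4) := by decide
    exact this.range_comp X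
  · have hX (i j : Fin 4) (h : j ≤ i) :
        (X j : MvPolynomial (Fin 4) k) ∈ supported k {l | l ≤ i} := X_mem_supported.2 h
    intro i
    fin_cases i
    · exact hX _ _ (by decide)
    · exact hX _ _ (by decide)
    · exact add_mem (hX _ _ (by decide))
        (mul_mem (pow_mem (hX _ _ (by decide)) _) (pow_mem (hX _ _ (by decide)) _))
    · exact add_mem (hX _ _ (by decide))
        (mul_mem (pow_mem (hX _ _ (by decide)) _) (pow_mem (hX _ _ (by decide)) _))
  · funext i
    fin_cases i <;> simp [comp]

theorem ofMatrix_fin_two (A : Matrix (Fin 2) (Fin 2) ℕ) :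
    ofMatrix k A = (![X 2 + X 0 ^ A 0 0 * X 1 ^ A 0 1, X 3 + X 0 ^ A 1 0 * X 1 ^ A 1 1, X 0, X 1] :
      AffEnd k 4) := by
  funext i
  fin_cases i
  · change X 2 + ∏ i, X (Fin.castAdd 2 i) ^ A 0 i = _
    rw [Fin.prod_univ_two]; rfl
  · change X 3 + ∏ i, X (Fin.castAdd 2 i) ^ A 1 i = _
    rw [Fin.prod_univ_two]; rfl
  · rfl
  · rfl

end AffEnd

/-! ### Spectral radius and the final statement. -/

theorem one_lt_spectralRadius_of_det_eq_zero {n : Type*} [Fintype n] [DecidableEq n]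
    {A : Matrix n n ℂ} {z : ℂ} (hz : 1 < ‖z‖) (h : (algebraMap ℂ (Matrix n n ℂ) z - A).det = 0) :
    1 < spectralRadius ℂ A := by
  have hmem : z ∈ spectrum ℂ A := by
    rw [spectrum.mem_iff, Matrix.isUnit_iff_isUnit_det, h]
    exact not_isUnit_zero
  refine lt_of_lt_of_le ?_ (le_iSup₂ (f := fun (z : ℂ) (_ : z ∈ spectrum ℂ A) => (‖z‖₊ : ENNReal))
    z hmem)
  exact_mod_cast hz

theorem mainTheorem9 (k : Type*) [Field k] (l : ℝ) (hl : IsWeakPerron l) (a b : ℤ)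
    (hmin : minpoly ℚ l =
      Polynomial.X ^ 2 - Polynomial.C (a : ℚ) * Polynomial.X - Polynomial.C (b : ℚ)) :
    0 ≤ a ∧
    (0 ≤ b → ∃ f : AffEnd k 3,
      f = ![X 2 + X 0 ^ a.toNat * X 1 ^ b.toNat, X 0, X 1] ∧
      f.IsShiftLike ∧ f.IsAutomorphism ∧ f.IsDynamicalDegree l) ∧
    (b < 0 →
      (∀ f : AffEnd k 3, f.IsAutomorphism → f.IsAffineTriangular → ¬ f.IsDynamicalDegree l) ∧
      ∃ A : Matrix (Fin 2) (Fin 2) ℕ,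
        A.map (fun m => (m : ℤ)) = !![a / 2, 1; a / 2 * (a - a / 2) + b, a - a / 2] ∧
        (A.map (fun m => (m : ℝ))).IsIrreducible ∧
        1 < spectralRadius ℂ (A.map (fun m => (m : ℂ))) ∧
        ∃ f : AffEnd k 4,
          f = ![X 2 + X 0 ^ A 0 0 * X 1 ^ A 0 1, X 3 + X 0 ^ A 1 0 * X 1 ^ A 1 1, X 0, X 1] ∧
          f = AffEnd.ofMatrix k A ∧
          f.IsAutomorphism ∧ f.IsPermutationTriangular ∧ f.IsDynamicalDegree l) := by
  have hsq := sq_eq_of_minpoly_eq hmin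
  have hirr := ne_ratCast_of_minpoly_eq hmin
  have habs := abs_le.1 (hl.abs_sub_le hmin)
  have hl1 : 1 < l := lt_of_le_of_ne hl.1 fun h => hirr 1 (by rw [← h]; norm_num)
  have ha : 0 ≤ a := by
    have : (0 : ℝ) ≤ a := by linarith [habs.1]
    exact_mod_cast this
  refine ⟨ha, fun hb => ?_, fun hb => ⟨fun f hf hf' hdeg => ?_, ?_⟩⟩
  · refine ⟨_, rfl, AffEnd.isShiftLike_shift _ _, AffEnd.isAutomorphism_shift _ _,
      AffEnd.isDynamicalDegree_shift hl1 ?_⟩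
    have h1 : ((a.toNat : ℤ) : ℝ) = a := by rw [Int.toNat_of_nonneg ha]
    have h2 : ((b.toNat : ℤ) : ℝ) = b := by rw [Int.toNat_of_nonneg hb]
    rw [Int.cast_natCast] at h1 h2
    rw [h1, h2, hsq]
  · rcases hdeg.leOneOrQuadratic hf hf' with h | ⟨a', b', h⟩
    · exact absurd h (not_le.2 hl1)
    · have := eq_of_sq_eq hmin hsq (a' := a') (b' := b') (by exact_mod_cast h)
      omega
  · have hbR : (b : ℝ) ≤ -1 := by exact_mod_cast Int.le_sub_one_of_lt hb
    have hla : l < a := by nlinarith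
    have ha2 : 2 ≤ a := by
      have : (1 : ℝ) < a := hl1.trans hla
      exact_mod_cast this
    have hhalf : (a : ℝ) < 2 * l := by
      refine lt_of_le_of_ne (by linarith [habs.1, habs.2]) fun h => hirr (a / 2) ?_
      push_cast
      linarith
    set u : ℤ := a / 2 with hu
    set v : ℤ := a - a / 2 with hv
    have hu1 : 1 ≤ u := by omega
    have hv1 : 1 ≤ v := by omega
    have huvR : (u : ℝ) + v = a := by
      have : u + v = a := by omega
      exact_mod_cast this
    have huv : v ≤ u + 1 ∧ u ≤ v := by omega
    have hu2 : (u : ℝ) < l := by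
      have : (u : ℝ) ≤ v := by exact_mod_cast huv.2
      linarith
    have hprod : (l - u) * (l - v) = ((u * v + b : ℤ) : ℝ) := by
      push_cast
      linear_combination hsq - l * huvR
    have hw : 0 < u * v + b := by
      have h1 : (-1 : ℝ) < ((u * v + b : ℤ) : ℝ) := by
        rw [← hprod]
        have : (v : ℝ) ≤ u + 1 := by exact_mod_cast huv.1
        have : (u : ℝ) ≤ v := by exact_mod_cast huv.2
        nlinarith [sq_nonneg (2 * l - a), sq_nonneg ((v : ℝ) - u)]
      have h2 : u * v + b ≠ 0 := by
        intro h0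
        rw [h0, Int.cast_zero, mul_eq_zero] at hprod
        rcases hprod with h | h
        · linarith
        · exact hirr v (by push_cast; linarith)
      have h3 : -1 < u * v + b := by exact_mod_cast h1
      omega
    clear_value u v
    obtain ⟨α, rfl⟩ := Int.eq_ofNat_of_zero_le (show 0 ≤ u by omega)
    obtain ⟨γ, rfl⟩ := Int.eq_ofNat_of_zero_le (show 0 ≤ v by omega)
    obtain ⟨β, hβ⟩ := Int.eq_ofNat_of_zero_le hw.le
    rw [hβ] at hprod hw ⊢
    rw [Int.cast_natCast] at hprod hu2 huvR
    refine ⟨!![α, 1; β, γ], ?_, ?_, ?_, _, rfl, (AffEnd.ofMatrix_fin_two _).symm,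
      AffEnd.isAutomorphism_double_shift _ _ _ _,
      AffEnd.isPermutationTriangular_double_shift _ _ _ _,
      AffEnd.isDynamicalDegree_double_shift hl1 hu2 hprod⟩
    · ext i j
      fin_cases i <;> fin_cases j <;> simp
    · have hpos (i j : Fin 2) : (0 : ℝ) < (!![α, 1; β, γ].map (fun m : ℕ => (m : ℝ))) i j := by
        have h1 : 0 < α := by omega
        have h2 : 0 < β := by omega
        have h3 : 0 < γ := by omega
        fin_cases i <;> fin_cases j <;> simp [h1, h2, h3]
      exact Matrix.IsPrimitive.isIrreducible
        ⟨fun i j => (hpos i j).le, 1, one_pos, fun i j => by rw [pow_one]; exact hpos i j⟩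
    · refine one_lt_spectralRadius_of_det_eq_zero (z := (l : ℂ)) ?_ ?_
      · rw [Complex.norm_real, Real.norm_eq_abs]
        exact hl1.trans_le (le_abs_self l)
      · have h := congrArg (fun x : ℝ => (x : ℂ)) hprod
        push_cast at h
        rw [Matrix.det_fin_two]
        simp [Matrix.algebraMap_matrix_apply]
        rw [h, sub_self]
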